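/- **Theorem (Orthogonality and Completeness).** Let $n,m\ge 1$ be integers and $-1<t<1$. Let $E=\{x\in\mathbb R^n: x_1+\cdots+x_n=0\}$, let $R=\{e_j-e_k: j\ne k\}$, $R^+=\{e_j-e_k: j<k\}$ and $\rho=\frac12\sum_{\alpha\in R^+}\alpha$, so that $\rho_j=\frac{n+1}{2}-j$, and let $\langle\cdot,\cdot\rangle$ be the standard inner product. Consider the finite grid $$P^{(m)}=\{\lambda\in E:\ \langle\lambda,\alpha\rangle\in\mathbb Z\ \ \forall\alpha\in R,\quad \lambda_1\ge\cdots\ge\lambda_n,\quad \lambda_1-\lambda_n\le m\}$$ with the weight function $$\Delta^{(m)}_\lambda=\prod_{\alpha\in R^+,\ \langle\lambda,\alpha\rangle=0}\frac{1-t^{\langle\rho,\alpha\rangle}}{1-t^{1+\langle\rho,\alpha\rangle}}\ \prod_{\alpha\in R^+,\ \langle\lambda,\alpha\rangle=m}\frac{1-t^{n-\langle\rho,\alpha\rangle}}{1-t^{1+n-\langle\rho,\alpha\rangle}} ,$$ and put $\langle\psi,\phi\rangle^{(m)}=\sum_{\lambda\in P^{(m)}}\psi_\lambda\overline{\phi_\lambda}\,\Delta^{(m)}_\lambda$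 for $\psi,\phi:P^{(m)}\to\mathbb C$. For $\mu\in P^{(m)}$, a *Bethe vector* with label $\mu$ is the orthogonal projection onto $E$ of a solution $y\in\mathbb R^n$ of $$m\,y_j+\sum_{l\ne j}\theta(y_j-y_l)=2\pi q_j\quad(1\le j\le n),\qquad \theta(x)=(1-t^2)\int_0^x\frac{dy}{1-2t\cos y+t^2},$$ for some $q\in\mathbb Z^n$ whose orthogonal projection onto $E$ is $\rho+\mu$. For $\lambda\in P^{(m)}$ and $\xi\in E$ with $2\pi>\xi_1-\xi_n$ and $\xi_1>\cdots>\xi_n$ the Bethe wave function is $$\Psi_\lambda(\xi)=\frac{1}{\delta(\xi)}\sum_{\sigma\in S_n}(-1)^\sigma\Bigl(\prod_{\alpha\in R^+}(1-t\,e^{-i\langle\alpha,\xi_\sigma\rangle})\Bigr)e^{i\langle\rho+\lambda,\xi_\sigma\rangle},\qquad \delta(\xi)=\prod_{\alpha\in R^+}\bigl(e^{i\langle\alpha,\xi\rangle/2}-e^{-i\langle\alpha,\xi\rangle/2}\bigr),$$ where $\xi_\sigma$ is $\xi$ with its components permuted by $\sigma$. Then $\Delta^{(m)}_\lambda>0$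 for all $\lambda\in P^{(m)}$. For every $\mu\in P^{(m)}$ there is exactly one Bethe vector $\xi_\mu$ with label $\mu$; it satisfies $\xi_{\mu,1}>\cdots>\xi_{\mu,n}$, $\xi_{\mu,1}-\xi_{\mu,n}<2\pi$, and it solves the Bethe system $$e^{im\langle\beta,\xi\rangle}=\Bigl(\frac{1-t\,e^{i\langle\beta,\xi\rangle}}{e^{i\langle\beta,\xi\rangle}-t}\Bigr)^2\prod_{\alpha\in R,\ \langle\alpha,\beta\rangle=1}\frac{1-t\,e^{i\langle\alpha,\xi\rangle}}{e^{i\langle\alpha,\xi\rangle}-t}\qquad\text{for all }\beta\in R .$$ The Bethe wave functions are the Hall–Littlewood polynomials specialized at the Bethe vectors: for all $\lambda,\mu\in P^{(m)}$, $$\Psi_\lambda(\xi_\mu)=\sum_{\sigma\in S_n}\Bigl(\prod_{\alpha\in R^+}\frac{1-t\,e^{-i\langle\alpha,\xi_{\sigma}\rangle}}{1-e^{-i\langle\alpha,\xi_{\sigma}\rangle}}\Bigr)e^{i\langle\lambda,\xi_{\sigma}\rangle}\Big|_{\xi=\xi_\mu} .$$ The functions $\Psi(\xi_\mu):\lambda\mapsto\Psi_\lambda(\xi_\mu)$,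 $\mu\in P^{(m)}$, form an orthogonal basis of the weighted space $\ell^2(P^{(m)},\Delta^{(m)})$ of complex functions on $P^{(m)}$: they are a basis of it, and $$\langle\Psi(\xi_\mu),\Psi(\xi_{\mu'})\rangle^{(m)}=0\ \text{ if }\mu\ne\mu',\qquad \langle\Psi(\xi_\mu),\Psi(\xi_\mu)\rangle^{(m)}>0 .$$ -/

import Mathlib

noncomputable section

namespace BetheGas

/-- The root `e_j - e_k` of `ℝⁿ` (equal to `0` when `j = k`); the standard inner product of `ℝⁿ`
is the dot product `⬝ᵥ`. -/
def root {n : ℕ} (j k : Fin n) : Fin n → ℝ := Pi.single j 1 - Pi.single k 1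

theorem root_dotProduct {n : ℕ} (j k : Fin n) (x : Fin n → ℝ) : root j k ⬝ᵥ x = x j - x k := by
  simp [root, sub_dotProduct]

/-- Index pairs `(j, k)`, `j ≠ k`, of the roots `e_j - e_k`. -/
def roots (n : ℕ) : Finset (Fin n × Fin n) := Finset.univ.filter fun p => p.1 ≠ p.2

/-- Index pairs `(j, k)`, `j < k`, of the positive roots `e_j - e_k`. -/
def posRoots (n : ℕ) : Finset (Fin n × Fin n) := Finset.univ.filter fun p => p.1 < p.2

/-- The center-of-mass plane `x₁ + ⋯ + xₙ = 0`. -/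
def plane (n : ℕ) : Set (Fin n → ℝ) := {x | ∑ j, x j = 0}

/-- The orthogonal projection of `ℝⁿ` onto the center-of-mass plane. -/
def center {n : ℕ} (x : Fin n → ℝ) : Fin n → ℝ := fun j => x j - (∑ l, x l) / n

/-- The root lattice. -/
def rootLattice (n : ℕ) : AddSubgroup (Fin n → ℝ) :=
  AddSubgroup.closure (Set.range fun p : Fin n × Fin n => root p.1 p.2)

/-- The weight lattice: the lattice in the center-of-mass plane dual to the root lattice. -/
def weightLattice (n : ℕ) : Set (Fin n → ℝ) :=
  {x | x ∈ plane n ∧ ∀ α ∈ rootLattice n, ∃ z : ℤ, α ⬝ᵥ x = z}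

/-- The dilated alcove `x₁ ≥ x₂ ≥ ⋯ ≥ xₙ`, `x₁ - xₙ ≤ r` in the center-of-mass plane. -/
def alcove (n : ℕ) (r : ℝ) : Set (Fin n → ℝ) :=
  {x | x ∈ plane n ∧ Antitone x ∧ ∀ j k, x j - x k ≤ r}

/-- The interior `x₁ > x₂ > ⋯ > xₙ`, `x₁ - xₙ < r` of the dilated alcove (for `r > 0`). -/
def openAlcove (n : ℕ) (r : ℝ) : Set (Fin n → ℝ) :=
  {x | x ∈ plane n ∧ StrictAnti x ∧ ∀ j k, x j - x k < r}

/-- The grid of the weights in the `m`-fold dilated alcove. -/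
def grid (n m : ℕ) : Set (Fin n → ℝ) := weightLattice n ∩ alcove n m

theorem grid_finite (n m : ℕ) : (grid n m).Finite := by
  classical
  rcases Nat.eq_zero_or_pos n with rfl | hn
  · exact Set.toFinite _
  -- a point of the plane is recovered from the differences of its coordinates
  let F : (Fin n → Fin n → ℤ) → (Fin n → ℝ) := fun d j => (∑ k, (d j k : ℝ)) / n
  have hfin : (Set.pi Set.univ fun _ : Fin n => Set.pi Set.univ
      fun _ : Fin n => Set.Icc (-(m : ℤ)) (m : ℤ)).Finite :=
    Set.Finite.pi fun _ => Set.Finite.pi fun _ => Set.finite_Icc _ _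
  refine (hfin.image F).subset ?_
  rintro x ⟨⟨hx0, hxZ⟩, -, -, hxm⟩
  have hz : ∀ j k : Fin n, ∃ z : ℤ, x j - x k = z := fun j k => by
    obtain ⟨z, hz⟩ := hxZ (root j k) (AddSubgroup.subset_closure ⟨(j, k), rfl⟩)
    exact ⟨z, by rw [← hz, root_dotProduct]⟩
  choose d hd using hz
  refine ⟨d, ?_, ?_⟩
  · intro j _ k _
    have h1 := hxm j k
    have h2 := hxm k j
    have h3 := hd j k
    constructor
    · have : (-(m : ℝ)) ≤ (d j k : ℝ) := by linarith
      exact_mod_cast this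
    · have : (d j k : ℝ) ≤ (m : ℝ) := by linarith
      exact_mod_cast this
  · funext j
    have hn' : (n : ℝ) ≠ 0 := by exact_mod_cast hn.ne'
    have h0 : ∑ k, x k = 0 := hx0
    simp only [F, ← hd, Finset.sum_sub_distrib, h0]
    simp [hn']

instance (n m : ℕ) : Fintype (grid n m) := (grid_finite n m).fintype

/-- Half the sum of the positive roots: `ρ_j = (n + 1) / 2 - j` for `j = 1, …, n`
(here the index `j` starts at `0`). -/
def rho (n : ℕ) : Fin n → ℝ := fun j => ((n : ℝ) - 1) / 2 - (j : ℕ)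

/-- The height `⟨ρ, e_j - e_k⟩ = k - j` of a positive root, as a natural number. -/
def height {n : ℕ} (p : Fin n × Fin n) : ℕ := (p.2 : ℕ) - (p.1 : ℕ)

theorem root_dotProduct_rho {n : ℕ} (p : Fin n × Fin n) (hp : p ∈ posRoots n) :
    root p.1 p.2 ⬝ᵥ rho n = height p := by
  have h : p.1 < p.2 := by simpa [posRoots] using hp
  have h' : (p.1 : ℕ) ≤ (p.2 : ℕ) := h.le
  rw [root_dotProduct, height, Nat.cast_sub h']
  simp only [rho]
  ring

/-- The weight function on the grid. -/
def weight (n m : ℕ) (t : ℝ) (l : Fin n → ℝ) : ℝ :=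
  (∏ p ∈ (posRoots n).filter (fun p => root p.1 p.2 ⬝ᵥ l = 0),
      (1 - t ^ height p) / (1 - t ^ (1 + height p))) *
  ∏ p ∈ (posRoots n).filter (fun p => root p.1 p.2 ⬝ᵥ l = m),
      (1 - t ^ (n - height p)) / (1 - t ^ (1 + n - height p))

/-- The inner product of the weighted space of complex functions on the grid. -/
def gridInner (n m : ℕ) (t : ℝ) (f g : grid n m → ℂ) : ℂ :=
  ∑ l : grid n m, f l * (starRingEnd ℂ) (g l) * (weight n m t l : ℂ)

/-- `e^{i ⟨x, y⟩}` -/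
def wave {n : ℕ} (x y : Fin n → ℝ) : ℂ := Complex.exp (Complex.I * ((x ⬝ᵥ y : ℝ) : ℂ))

/-- The Weyl denominator `∏_{α > 0} (e^{i⟨α,ξ⟩/2} - e^{-i⟨α,ξ⟩/2})`. -/
def weylDenominator {n : ℕ} (ξ : Fin n → ℝ) : ℂ :=
  ∏ p ∈ posRoots n,
    (wave ((1 / 2 : ℝ) • root p.1 p.2) ξ - wave (-((1 / 2 : ℝ) • root p.1 p.2)) ξ)

/-- The coefficient `∏_{α > 0} (1 - t e^{-i⟨α,ξ⟩})` of the Bethe Ansatz. -/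
def betheCoeff {n : ℕ} (t : ℝ) (ξ : Fin n → ℝ) : ℂ :=
  ∏ p ∈ posRoots n, (1 - (t : ℂ) * wave (-root p.1 p.2) ξ)

/-- The Bethe Ansatz wave function with spectral parameter `ξ`, at the point `l`: an alternating
sum of plane waves over the permutations of the components of `ξ`. -/
def betheWave {n : ℕ} (t : ℝ) (l ξ : Fin n → ℝ) : ℂ :=
  (1 / weylDenominator ξ) * ∑ σ : Equiv.Perm (Fin n),
    ((Equiv.Perm.sign σ : ℤ) : ℂ) * betheCoeff t (ξ ∘ σ) * wave (rho n + l) (ξ ∘ σ)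

/-- The Hall--Littlewood polynomial with label `l` and parameter `t`, in the variables
`e^{iξ₁}, …, e^{iξₙ}`. -/
def hallLittlewood {n : ℕ} (t : ℝ) (l ξ : Fin n → ℝ) : ℂ :=
  ∑ σ : Equiv.Perm (Fin n),
    (∏ p ∈ posRoots n, (1 - (t : ℂ) * wave (-root p.1 p.2) (ξ ∘ σ)) /
      (1 - wave (-root p.1 p.2) (ξ ∘ σ))) * wave l (ξ ∘ σ)

/-- The algebraic Bethe system, one equation for every root `β = e_b₁ - e_b₂`. -/
def BetheSystem {n : ℕ} (m : ℕ) (t : ℝ) (ξ : Fin n → ℝ) : Prop :=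
  ∀ b ∈ roots n,
    wave (root b.1 b.2) ξ ^ m =
      ((1 - (t : ℂ) * wave (root b.1 b.2) ξ) / (wave (root b.1 b.2) ξ - (t : ℂ))) ^ 2 *
      ∏ a ∈ (roots n).filter (fun a => root a.1 a.2 ⬝ᵥ root b.1 b.2 = 1),
        (1 - (t : ℂ) * wave (root a.1 a.2) ξ) / (wave (root a.1 a.2) ξ - (t : ℂ))

/-- The phase `θ(x) = (1 - t²) ∫₀ˣ (1 - 2 t cos y + t²)⁻¹ dy`. -/
def theta (t x : ℝ) : ℝ :=
  (1 - t ^ 2) * ∫ y in (0 : ℝ)..x, (1 - 2 * t * Real.cos y + t ^ 2)⁻¹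

/-- The logarithmic Bethe equations with integer quantum numbers `q₁, …, qₙ`. -/
def LogBetheSystem {n : ℕ} (m : ℕ) (t : ℝ) (q : Fin n → ℤ) (y : Fin n → ℝ) : Prop :=
  ∀ j, (m : ℝ) * y j + ∑ l ∈ Finset.univ.erase j, theta t (y j - y l) = 2 * Real.pi * (q j : ℝ)

/-- `ξ` is a Bethe vector with label `μ`: it is the projection onto the center-of-mass plane of a
solution of the logarithmic Bethe equations whose quantum numbers project to `ρ + μ`. -/
def IsBetheVector {n : ℕ} (m : ℕ) (t : ℝ) (μ ξ : Fin n → ℝ) : Prop :=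
  ∃ (q : Fin n → ℤ) (y : Fin n → ℝ), center (fun j => (q j : ℝ)) = rho n + μ ∧
    LogBetheSystem m t q y ∧ ξ = center y

end BetheGas

end

noncomputable section

namespace BetheGas

/-! The logarithmic Bethe equations are the critical point equations of the Yang–Yang potential
`yangYang`, which is coercive: this gives solutions (`exists_logBetheSystem`). Since θ is
increasing, a maximum principle shows that the quantum numbers, taken modulo a common shift,
determine the solution modulo a common shift (`LogBetheSystem.center_eq`). Monotonicity and the
increment of θ over a period place the Bethe vectors in the open alcove. Since e^{iθ(x)} is a Möbius
function of e^{ix}, exponentiation yields the algebraic Bethe equations.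

Orthogonality comes from commuting discrete Laplacians. Write N(λ) for the alternating sum in the
wave function and 1_S for the indicator vector of a set S of coordinates. On all of ℝⁿ, the sum of
N(λ + 1_S) over |S| = r equals e_r(e^{iξ}) N(λ), with e_r the elementary symmetric polynomial. The
coefficients of the Bethe Ansatz make N satisfy a boundary relation at each wall of the Weyl chamber
(`betheNumerator_swap`). The Bethe equations provide the affine wall, in the form of
quasi-invariance under the cyclic symmetry of the dilated alcove (`betheNumerator_rot`).

These relations fold the terms that leave the alcove back into it. A folded term acquires a power of
t that counts inversions, and the Gaussian binomial theorem sums these powers (`sum_pow_colorInv`).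
After multiplication by Δ, the coefficient linking two neighbours λ, λ' becomes a product over the
walls that contain both (`pairWeight_mul_sum`). It is symmetric in λ and λ', so the Laplacians with
indices r and n - r are adjoint (`sum_weight_adjoint`).

On the plane of sum zero the conjugate of e_{n-r} is e_r. Adjointness therefore gives (e_r(ξ) -
e_r(η))⟨Ψ(ξ), Ψ(η)⟩ = 0 for all r, and the e_r separate points of the open alcove
(`eq_of_waveEsymm_eq`). Each norm is positive because Ψ at λ = 0 is essentially the Poincaré
polynomial of S_n, which has no zero for |t| < 1. The functions are as many as the grid points, so
they form a basis. -/

/-! ### The phase θ. -/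

theorem poisson_denominator_pos {t : ℝ} (ht : -1 < t) (ht' : t < 1) (y : ℝ) :
    0 < 1 - 2 * t * Real.cos y + t ^ 2 := by
  have h1 := Real.neg_one_le_cos y
  have h2 := Real.cos_le_one y
  nlinarith [sq_nonneg (t - Real.cos y), Real.sin_sq_add_cos_sq y, sq_nonneg (Real.sin y),
    mul_pos (by linarith : 0 < 1 + t) (by linarith : 0 < 1 - t), sq_nonneg (1 - t), sq_nonneg (1+t)]

theorem continuous_poisson {t : ℝ} (ht : -1 < t) (ht' : t < 1) :
    Continuous fun y : ℝ => (1 - 2 * t * Real.cos y + t ^ 2)⁻¹ :=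
  Continuous.inv₀ (by fun_prop) fun y => (poisson_denominator_pos ht ht' y).ne'

theorem hasDerivAt_theta {t : ℝ} (ht : -1 < t) (ht' : t < 1) (x : ℝ) :
    HasDerivAt (theta t) ((1 - t ^ 2) * (1 - 2 * t * Real.cos x + t ^ 2)⁻¹) x :=
  ((continuous_poisson ht ht').integral_hasStrictDerivAt 0 x).hasDerivAt.const_mul _

theorem continuous_theta {t : ℝ} (ht : -1 < t) (ht' : t < 1) : Continuous (theta t) :=
  continuous_iff_continuousAt.2 fun x => (hasDerivAt_theta ht ht' x).continuousAt

theorem theta_zero (t : ℝ) : theta t 0 = 0 := by simp [theta]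

theorem theta_strictMono {t : ℝ} (ht : -1 < t) (ht' : t < 1) : StrictMono (theta t) := by
  refine strictMono_of_deriv_pos fun x => ?_
  rw [(hasDerivAt_theta ht ht' x).deriv]
  have := poisson_denominator_pos ht ht' x
  have : 0 < 1 - t ^ 2 := by nlinarith
  positivity

theorem theta_neg (t x : ℝ) : theta t (-x) = -theta t x := by
  have h := intervalIntegral.integral_comp_neg (a := 0) (b := x)
    fun y : ℝ => (1 - 2 * t * Real.cos y + t ^ 2)⁻¹
  simp only [Real.cos_neg, neg_zero] at h
  rw [theta, theta, h, intervalIntegral.integral_symm]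
  ring

theorem one_sub_mul_ne_zero {t : ℝ} (ht : -1 < t) (ht' : t < 1) {z : ℂ} (hz : ‖z‖ = 1) :
    1 - (t : ℂ) * z ≠ 0 := by
  intro h
  have h1 : (t : ℂ) * z = 1 := (sub_eq_zero.1 h).symm
  have h2 := congrArg norm h1
  rw [norm_mul, hz, Complex.norm_real, mul_one, norm_one, Real.norm_eq_abs] at h2
  have := abs_lt.2 ⟨ht, ht'⟩
  linarith

theorem sub_ne_zero_of_norm_one {t : ℝ} (ht : -1 < t) (ht' : t < 1) {z : ℂ} (hz : ‖z‖ = 1) :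
    z - (t : ℂ) ≠ 0 := by
  intro h
  have h2 := congrArg norm (sub_eq_zero.1 h)
  rw [hz, Complex.norm_real, Real.norm_eq_abs] at h2
  have := abs_lt.2 ⟨ht, ht'⟩
  linarith

/-- The phase factor `e^{iθ(x)}` is a Möbius transformation of `e^{ix}`. -/
theorem exp_theta {t : ℝ} (ht : -1 < t) (ht' : t < 1) (x : ℝ) :
    Complex.exp (Complex.I * (theta t x : ℂ)) * (1 - t * Complex.exp (Complex.I * x)) =
      Complex.exp (Complex.I * x) - t := by
  have hn : ∀ x : ℝ, ‖Complex.exp (Complex.I * x)‖ = 1 := fun x => by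
    rw [mul_comm]; exact Complex.norm_exp_ofReal_mul_I x
  -- The quotient of the two sides. The factorization `hp'` of the Poisson denominator makes its
  -- derivative vanish, so it keeps its value 1 at the origin.
  let f : ℝ → ℂ := fun x => Complex.exp (Complex.I * (theta t x : ℂ)) *
    ((1 - t * Complex.exp (Complex.I * x)) / (Complex.exp (Complex.I * x) - t))
  have hd : ∀ x, HasDerivAt f 0 x := by
    intro x
    have h1 := ((hasDerivAt_theta ht ht' x).ofReal_comp.const_mul Complex.I).cexp
    have h2 : HasDerivAt (fun x : ℝ => Complex.exp (Complex.I * (x : ℂ)))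
        (Complex.exp (Complex.I * x) * (Complex.I * 1)) x :=
      ((hasDerivAt_id x).ofReal_comp.const_mul Complex.I).cexp
    have hne := sub_ne_zero_of_norm_one ht ht' (hn x)
    have hne' := one_sub_mul_ne_zero ht ht' (hn x)
    have h3 := h1.mul (((h2.const_mul (t : ℂ)).const_sub 1).div (h2.sub_const (t : ℂ)) hne)
    refine h3.congr_deriv ?_
    have hp := (poisson_denominator_pos ht ht' x).ne'
    have hp' : ((1 - 2 * t * Real.cos x + t ^ 2 : ℝ) : ℂ) *
        Complex.exp (Complex.I * x) =
        (Complex.exp (Complex.I * x) - t) * (1 - t * Complex.exp (Complex.I * x)) := by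
      have hc : (2 : ℂ) * Complex.cos x * Complex.exp (Complex.I * x) =
          Complex.exp (Complex.I * x) ^ 2 + 1 := by
        rw [Complex.cos, mul_comm (x : ℂ) Complex.I, show -(x : ℂ) * Complex.I = -(Complex.I * x) by ring,
          Complex.exp_neg]
        field_simp [Complex.exp_ne_zero]
      push_cast
      linear_combination (-(t : ℂ)) * hc
    have hE := Complex.exp_ne_zero (Complex.I * x)
    have hpc : ((1 - 2 * t * Real.cos x + t ^ 2 : ℝ) : ℂ)⁻¹ =
        Complex.exp (Complex.I * x) /
        ((Complex.exp (Complex.I * x) - t) * (1 - t * Complex.exp (Complex.I * x))) := by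
      rw [← hp']
      have : ((1 - 2 * t * Real.cos x + t ^ 2 : ℝ) : ℂ) ≠ 0 := by exact_mod_cast hp
      field_simp
    rw [Complex.ofReal_mul, Complex.ofReal_inv, hpc]
    simp only [Pi.div_apply]
    push_cast
    field_simp
    ring
  have hc : f x = f 0 := is_const_of_deriv_eq_zero (fun x => (hd x).differentiableAt)
    (fun x => (hd x).deriv) x 0
  have h0 : f 0 = 1 := by
    have : (1 : ℂ) - t ≠ 0 := by
      have := sub_ne_zero_of_norm_one ht ht' (z := 1) (by simp)
      exact this
    simp [f, theta_zero, this]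
  have hne := sub_ne_zero_of_norm_one ht ht' (hn x)
  rw [h0] at hc
  simp only [f] at hc
  rw [← mul_div_assoc, div_eq_one_iff_eq hne] at hc
  exact hc

/-- By the Möbius formula e^{iθ(2π)} = 1, so θ(2π) is an integer multiple of 2π; it is positive by
monotonicity. Only this lower bound is needed later. -/
theorem two_pi_le_theta {t : ℝ} (ht : -1 < t) (ht' : t < 1) :
    2 * Real.pi ≤ theta t (2 * Real.pi) := by
  have h := exp_theta ht ht' (2 * Real.pi)
  have h1 : Complex.exp (Complex.I * ((2 * Real.pi : ℝ) : ℂ)) = 1 := by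
    rw [mul_comm]; push_cast; exact Complex.exp_two_pi_mul_I
  have hne : (1 : ℂ) - t ≠ 0 := sub_ne_zero_of_norm_one ht ht' (by simp)
  rw [h1, mul_one] at h
  have h2 : Complex.exp (Complex.I * (theta t (2 * Real.pi) : ℂ)) = 1 :=
    mul_right_cancel₀ hne (by rw [h, one_mul])
  obtain ⟨k, hk⟩ := Complex.exp_eq_one_iff.1 h2
  have hk' : theta t (2 * Real.pi) = k * (2 * Real.pi) := by
    have : (theta t (2 * Real.pi) : ℂ) = k * (2 * Real.pi) := by
      apply mul_left_cancel₀ Complex.I_ne_zero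
      rw [hk]; ring
    exact_mod_cast this
  have hpos : 0 < theta t (2 * Real.pi) := by
    rw [← theta_zero t]; exact theta_strictMono ht ht' Real.two_pi_pos
  have hk0 : (0 : ℝ) < k := by
    rw [hk'] at hpos
    exact pos_of_mul_pos_left hpos Real.two_pi_pos.le
  have hk1 : (1 : ℝ) ≤ k := by exact_mod_cast (by exact_mod_cast hk0 : (0 : ℤ) < k)
  rw [hk']
  nlinarith [Real.two_pi_pos]

/-- The derivative of θ is 2π-periodic, so the increment over a period does not depend on x. -/
theorem theta_add_two_pi {t : ℝ} (ht : -1 < t) (ht' : t < 1) (x : ℝ) :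
    theta t x + 2 * Real.pi ≤ theta t (x + 2 * Real.pi) := by
  let f : ℝ → ℝ := fun x => theta t (x + 2 * Real.pi) - theta t x
  have hd : ∀ x, HasDerivAt f 0 x := fun x => by
    have h := ((hasDerivAt_theta ht ht' (x + 2 * Real.pi)).comp_add_const x (2 * Real.pi)).sub
      (hasDerivAt_theta ht ht' x)
    rw [Real.cos_add_two_pi, sub_self] at h
    exact h
  have hc : f x = f 0 := is_const_of_deriv_eq_zero (fun x => (hd x).differentiableAt)
    (fun x => (hd x).deriv) x 0
  simp only [f, theta_zero, zero_add, sub_zero] at hc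
  linarith [two_pi_le_theta ht ht']

theorem integral_theta_nonneg {t : ℝ} (ht : -1 < t) (ht' : t < 1) (x : ℝ) :
    0 ≤ ∫ u in (0 : ℝ)..x, theta t u := by
  rcases le_total 0 x with hx | hx
  · refine intervalIntegral.integral_nonneg hx fun u hu => ?_
    rw [← theta_zero t]
    exact (theta_strictMono ht ht').monotone hu.1
  · rw [intervalIntegral.integral_symm, ← intervalIntegral.integral_neg]
    refine intervalIntegral.integral_nonneg hx fun u hu => ?_
    rw [← theta_neg, ← theta_zero t]
    exact (theta_strictMono ht ht').monotone (by linarith [hu.2])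

/-! ### Existence and uniqueness for the logarithmic Bethe equations. -/

/-- The convex potential whose critical points solve the logarithmic Bethe equations. -/
def yangYang {n : ℕ} (m : ℕ) (t : ℝ) (q : Fin n → ℤ) (y : Fin n → ℝ) : ℝ :=
  (m : ℝ) / 2 * ∑ k, y k ^ 2 + 1 / 2 * ∑ k, ∑ l, (∫ u in (0 : ℝ)..(y k - y l), theta t u) -
    2 * Real.pi * ∑ k, q k * y k

theorem hasDerivAt_integral_theta {t : ℝ} (ht : -1 < t) (ht' : t < 1) (x : ℝ) :
    HasDerivAt (fun x => ∫ u in (0 : ℝ)..x, theta t u) (theta t x) x :=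
  ((continuous_theta ht ht').integral_hasStrictDerivAt 0 x).hasDerivAt

/-- The interaction terms are nonnegative and the quadratic term dominates the linear one, so
outside a compact set the potential is at least its value 0 at the origin. -/
theorem exists_yangYang_le {n m : ℕ} (hm : 1 ≤ m) {t : ℝ} (ht : -1 < t) (ht' : t < 1)
    (q : Fin n → ℤ) : ∃ y, ∀ z, yangYang m t q y ≤ yangYang m t q z := by
  have hcI : Continuous fun x => ∫ u in (0 : ℝ)..x, theta t u :=
    continuous_iff_continuousAt.2 fun x => (hasDerivAt_integral_theta ht ht' x).continuousAt
  have hcont : Continuous (yangYang m t q) := by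
    unfold yangYang
    have h : ∀ k l : Fin n, Continuous fun y : Fin n → ℝ =>
        ∫ u in (0 : ℝ)..(y k - y l), theta t u := fun k l =>
      hcI.comp ((continuous_apply k).sub (continuous_apply l))
    fun_prop
  refine hcont.exists_forall_le' 0 ?_
  have hm' : (1 : ℝ) ≤ m := by exact_mod_cast hm
  -- From 2πqy ≤ y²/4 + (2πq)² the potential is at least (Σ y²)/4 - K, which is nonnegative once Σ
  -- y² ≥ 4K.
  set K : ℝ := ∑ k, (2 * Real.pi * q k) ^ 2 with hK
  have hev := tendsto_norm_cocompact_atTop (E := Fin n → ℝ) |>.eventually_gt_atTop (√(4 * K))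
  filter_upwards [hev] with y hy
  have h0 : yangYang m t q 0 = 0 := by simp [yangYang]
  have hsq : 4 * K ≤ ∑ k, y k ^ 2 := by
    by_contra! hlt
    refine hy.not_ge ((pi_norm_le_iff_of_nonneg (Real.sqrt_nonneg _)).2 fun k => ?_)
    rw [Real.norm_eq_abs]
    refine Real.abs_le_sqrt (le_trans ?_ hlt.le)
    exact Finset.single_le_sum (f := fun k => y k ^ 2) (fun _ _ => sq_nonneg _) (Finset.mem_univ k)
  have hI : 0 ≤ ∑ k, ∑ l, (∫ u in (0 : ℝ)..(y k - y l), theta t u) :=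
    Finset.sum_nonneg fun _ _ => Finset.sum_nonneg fun _ _ => integral_theta_nonneg ht ht' _
  have hS : 2 * Real.pi * ∑ k, q k * y k ≤ 1 / 4 * ∑ k, y k ^ 2 + K := by
    rw [hK, Finset.mul_sum, Finset.mul_sum, ← Finset.sum_add_distrib]
    refine Finset.sum_le_sum fun k _ => ?_
    nlinarith [sq_nonneg (y k / 2 - 2 * Real.pi * q k)]
  have hS0 : 0 ≤ ∑ k, y k ^ 2 := Finset.sum_nonneg fun _ _ => sq_nonneg _
  rw [h0, yangYang]
  nlinarith

theorem exists_logBetheSystem {n m : ℕ} (hm : 1 ≤ m) {t : ℝ} (ht : -1 < t) (ht' : t < 1)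
    (q : Fin n → ℤ) : ∃ y, LogBetheSystem m t q y := by
  classical
  obtain ⟨y, hy⟩ := exists_yangYang_le hm ht ht' q
  refine ⟨y, fun j => ?_⟩
  let w : Fin n → ℝ := Pi.single j 1
  let f : ℝ → ℝ := fun s => yangYang m t q fun k => y k + s * w k
  have hy0 : (fun k => y k + 0 * w k) = y := by funext k; ring
  have hlin : ∀ k, HasDerivAt (fun s : ℝ => y k + s * w k) (w k) 0 := fun k => by
    simpa using ((hasDerivAt_id (0 : ℝ)).mul_const (w k)).const_add (y k)
  have hd : HasDerivAt f ((m : ℝ) / 2 * ∑ k, (2 * y k * w k) +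
      1 / 2 * ∑ k, ∑ l, theta t (y k - y l) * (w k - w l) - 2 * Real.pi * ∑ k, q k * w k) 0 := by
    refine HasDerivAt.sub (HasDerivAt.add (HasDerivAt.const_mul _ (HasDerivAt.fun_sum fun k _ => ?_))
      (HasDerivAt.const_mul _ (HasDerivAt.fun_sum fun k _ => HasDerivAt.fun_sum fun l _ => ?_)))
      (HasDerivAt.const_mul _ (HasDerivAt.fun_sum fun k _ => ?_))
    · simpa using (hlin k).fun_pow 2
    · have h := (hasDerivAt_integral_theta ht ht' (y k - y l))
      have h2 := (hlin k).sub (hlin l)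
      refine HasDerivAt.comp (0 : ℝ) (h₂ := fun x => ∫ u in (0 : ℝ)..x, theta t u) ?_ h2
      simpa using h
    · exact (hlin k).const_mul _
  have hmin : IsLocalMin f 0 := Filter.Eventually.of_forall fun s => by
    simp only [f]
    rw [hy0]
    exact hy _
  have h0 := hmin.hasDerivAt_eq_zero hd
  -- Since θ is odd, both halves of the double sum agree; the resulting factor 2 cancels the 1/2 in
  -- the potential.
  have hsym : ∑ k, ∑ l, theta t (y k - y l) * (w k - w l) =
      2 * ∑ k, w k * ∑ l, theta t (y k - y l) := by
    have h1 : ∑ k, ∑ l, theta t (y k - y l) * w l = -∑ k, ∑ l, theta t (y k - y l) * w k := by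
      rw [Finset.sum_comm, ← Finset.sum_neg_distrib]
      refine Finset.sum_congr rfl fun k _ => ?_
      rw [← Finset.sum_neg_distrib]
      refine Finset.sum_congr rfl fun l _ => ?_
      rw [← neg_sub, theta_neg]
      ring
    simp only [mul_sub, Finset.sum_sub_distrib]
    rw [h1]
    simp only [← Finset.sum_mul]
    rw [sub_neg_eq_add, ← two_mul]
    congr 1
    exact Finset.sum_congr rfl fun k _ => mul_comm _ _
  have hw : ∀ g : Fin n → ℝ, ∑ k, w k * g k = g j := fun g => by
    simp [w, Pi.single_apply]
  have hw1 : ∑ k, (2 * y k * w k) = 2 * y j := by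
    rw [← hw fun k => 2 * y k]; exact Finset.sum_congr rfl fun k _ => mul_comm _ _
  have hw2 : ∑ k, (q k : ℝ) * w k = q j := by
    rw [← hw fun k => (q k : ℝ)]; exact Finset.sum_congr rfl fun k _ => mul_comm _ _
  rw [hsym, hw, hw1, hw2] at h0
  have he : ∑ l ∈ Finset.univ.erase j, theta t (y j - y l) = ∑ l, theta t (y j - y l) := by
    rw [← Finset.add_sum_erase _ _ (Finset.mem_univ j), sub_self, theta_zero, zero_add]
  rw [he]
  linarith

theorem logBetheSystem_iff {n m : ℕ} {t : ℝ} {q : Fin n → ℤ} {y : Fin n → ℝ} :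
    LogBetheSystem m t q y ↔
      ∀ j, (m : ℝ) * y j + ∑ l, theta t (y j - y l) = 2 * Real.pi * (q j : ℝ) := by
  refine forall_congr' fun j => ?_
  rw [← Finset.add_sum_erase _ _ (Finset.mem_univ j), sub_self, theta_zero, zero_add]

theorem center_eq_center_iff {n : ℕ} {x y : Fin n → ℝ} :
    center x = center y ↔ ∀ j k, x j - y j = x k - y k := by
  constructor
  · intro h j k
    have h1 := congrFun h j
    have h2 := congrFun h k
    simp only [center] at h1 h2
    linarith
  · intro h
    funext j
    have hn : (n : ℝ) ≠ 0 := by exact_mod_cast (Fin.pos j).ne'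
    have hs : ∑ l, x l - ∑ l, y l = n * (x j - y j) := by
      rw [← Finset.sum_sub_distrib, Finset.sum_congr rfl fun l _ => h l j]
      simp
      ring
    simp only [center]
    field_simp
    linarith

theorem center_sub {n : ℕ} (x : Fin n → ℝ) (j k : Fin n) :
    center x j - center x k = x j - x k := by simp [center]

theorem center_mem_plane {n : ℕ} (hn : 1 ≤ n) (x : Fin n → ℝ) : center x ∈ plane n := by
  have : (n : ℝ) ≠ 0 := by positivity
  simp only [plane, Set.mem_ofPred_eq, center, Finset.sum_sub_distrib]
  simp
  field_simp
  ring

theorem center_eq_self {n : ℕ} {x : Fin n → ℝ} (hx : x ∈ plane n) : center x = x := by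
  funext j
  have : ∑ l, x l = 0 := hx
  simp [center, this]

/-- Solutions of the logarithmic Bethe equations whose quantum numbers differ by a constant
differ by a constant. -/
theorem LogBetheSystem.center_eq {n m : ℕ} (hm : 1 ≤ m) {t : ℝ} (ht : -1 < t) (ht' : t < 1)
    {q q' : Fin n → ℤ} {y y' : Fin n → ℝ} (h : LogBetheSystem m t q y)
    (h' : LogBetheSystem m t q' y')
    (hq : center (fun j => (q j : ℝ)) = center fun j => (q' j : ℝ)) : center y = center y' := by
  rw [logBetheSystem_iff] at h h'
  rw [center_eq_center_iff] at hq ⊢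
  rcases isEmpty_or_nonempty (Fin n) with he | he
  · exact fun j => he.elim j
  have hm' : (0 : ℝ) < m := by exact_mod_cast hm
  -- Maximum principle: where y - y' is largest, every difference y a - y l dominates that of y',
  -- hence so does the sum of phases; at the minimum the order is reversed. Comparing the equations
  -- at a and b gives max ≤ min.
  obtain ⟨a, -, ha⟩ := Finset.exists_max_image Finset.univ (fun j => y j - y' j) Finset.univ_nonempty
  obtain ⟨b, -, hb⟩ := Finset.exists_min_image Finset.univ (fun j => y j - y' j) Finset.univ_nonempty
  have ha1 : ∑ l, theta t (y' a - y' l) ≤ ∑ l, theta t (y a - y l) :=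
    Finset.sum_le_sum fun l _ => (theta_strictMono ht ht').monotone
      (by linarith [ha l (Finset.mem_univ l)])
  have hb1 : ∑ l, theta t (y b - y l) ≤ ∑ l, theta t (y' b - y' l) :=
    Finset.sum_le_sum fun l _ => (theta_strictMono ht ht').monotone
      (by linarith [hb l (Finset.mem_univ l)])
  have hab : (m : ℝ) * (y a - y' a) ≤ m * (y b - y' b) := by
    have h1 := h a
    have h2 := h' a
    have h3 := h b
    have h4 := h' b
    have h5 : 2 * Real.pi * ((q a : ℝ) - q' a) = 2 * Real.pi * ((q b : ℝ) - q' b) := by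
      rw [hq a b]
    linarith
  have hab' := le_of_mul_le_mul_left hab hm'
  intro j k
  linarith [ha j (Finset.mem_univ j), ha k (Finset.mem_univ k), hb j (Finset.mem_univ j),
    hb k (Finset.mem_univ k)]

/-- The phases see only differences of coordinates, so the equations recover the quantum numbers up
to a shift. Hence different labels have different Bethe vectors. -/
theorem LogBetheSystem.center_quantum_eq {n m : ℕ} {t : ℝ}
    {q q' : Fin n → ℤ} {y y' : Fin n → ℝ} (h : LogBetheSystem m t q y)
    (h' : LogBetheSystem m t q' y') (hy : center y = center y') :
    center (fun j => (q j : ℝ)) = center fun j => (q' j : ℝ) := by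
  rw [logBetheSystem_iff] at h h'
  rw [center_eq_center_iff] at hy ⊢
  have hth : ∀ j, ∑ l, theta t (y j - y l) = ∑ l, theta t (y' j - y' l) := fun j =>
    Finset.sum_congr rfl fun l _ => by rw [show y j - y l = y' j - y' l by linarith [hy j l]]
  intro j k
  have h1 := h j
  have h2 := h' j
  have h3 := h k
  have h4 := h' k
  rw [hth] at h1 h3
  have h5 : (m : ℝ) * (y j - y' j) = m * (y k - y' k) := by rw [hy j k]
  apply mul_left_cancel₀ Real.two_pi_pos.ne'
  linarith

/-! ### Bethe vectors and their position in the alcove. -/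

theorem sum_rho (n : ℕ) : ∑ j, rho n j = 0 := by
  have h : (∑ i ∈ Finset.range n, (i : ℝ)) = n * ((n : ℝ) - 1) / 2 := by
    induction n with
    | zero => simp
    | succ k ih => rw [Finset.sum_range_succ, ih]; push_cast; ring
  simp only [rho, Finset.sum_sub_distrib]
  rw [Fin.sum_univ_eq_sum_range (fun i => (i : ℝ)), h]
  simp
  ring

theorem weightLattice_sub {n : ℕ} {x : Fin n → ℝ} (hx : x ∈ weightLattice n) (j k : Fin n) :
    ∃ z : ℤ, x j - x k = z := by
  obtain ⟨z, hz⟩ := hx.2 (root j k) (AddSubgroup.subset_closure ⟨(j, k), rfl⟩)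
  exact ⟨z, by rw [← hz, root_dotProduct]⟩

theorem mem_weightLattice_iff {n : ℕ} {x : Fin n → ℝ} :
    x ∈ weightLattice n ↔ x ∈ plane n ∧ ∀ j k, ∃ z : ℤ, x j - x k = z := by
  refine ⟨fun h => ⟨h.1, weightLattice_sub h⟩, fun h => ⟨h.1, fun α hα => ?_⟩⟩
  induction hα using AddSubgroup.closure_induction with
  | mem a ha =>
    obtain ⟨p, rfl⟩ := ha
    obtain ⟨z, hz⟩ := h.2 p.1 p.2
    exact ⟨z, by rw [root_dotProduct, hz]⟩
  | zero => exact ⟨0, by simp⟩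
  | add a b _ _ ha hb =>
    obtain ⟨z, hz⟩ := ha
    obtain ⟨w, hw⟩ := hb
    exact ⟨z + w, by rw [add_dotProduct, hz, hw]; push_cast; ring⟩
  | neg a _ ha =>
    obtain ⟨z, hz⟩ := ha
    exact ⟨-z, by rw [neg_dotProduct, hz]; push_cast; ring⟩

theorem exists_isBetheVector {n m : ℕ} (hn : 1 ≤ n) (hm : 1 ≤ m) {t : ℝ} (ht : -1 < t)
    (ht' : t < 1) {μ : Fin n → ℝ} (hμ : μ ∈ weightLattice n) : ∃ ξ, IsBetheVector m t μ ξ := by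
  let o : Fin n := ⟨0, hn⟩
  -- The coordinates of ρ + μ need not be integers, but their differences are. The choice q_o = 0 is
  -- harmless because the projection ignores a common shift.
  have hz : ∀ j, ∃ z : ℤ, (rho n + μ) j - (rho n + μ) o = z := fun j => by
    obtain ⟨z, hz⟩ := weightLattice_sub hμ j o
    refine ⟨z - (j : ℕ), ?_⟩
    push_cast
    rw [← hz]
    simp [rho, o]
    ring
  choose q hq using hz
  obtain ⟨y, hy⟩ := exists_logBetheSystem hm ht ht' q
  refine ⟨center y, q, y, ?_, hy, rfl⟩
  have hp : rho n + μ ∈ plane n := by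
    have : ∑ j, μ j = 0 := hμ.1
    simp [plane, Finset.sum_add_distrib, sum_rho, this]
  rw [← center_eq_self hp, center_eq_center_iff]
  intro j k
  rw [← hq, ← hq]
  ring

theorem IsBetheVector.unique {n m : ℕ} (hm : 1 ≤ m) {t : ℝ} (ht : -1 < t)
    (ht' : t < 1) {μ ξ η : Fin n → ℝ} (h : IsBetheVector m t μ ξ) (h' : IsBetheVector m t μ η) :
    η = ξ := by
  obtain ⟨q, y, hq, hy, rfl⟩ := h
  obtain ⟨q', y', hq', hy', rfl⟩ := h'
  exact hy'.center_eq hm ht ht' hy (hq'.trans hq.symm)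

theorem IsBetheVector.label_unique {n m : ℕ} {t : ℝ} {μ ν ξ : Fin n → ℝ}
    (h : IsBetheVector m t μ ξ) (h' : IsBetheVector m t ν ξ) : μ = ν := by
  obtain ⟨q, y, hq, hy, rfl⟩ := h
  obtain ⟨q', y', hq', hy', hyy⟩ := h'
  have := hy.center_quantum_eq hy' hyy
  rw [hq, hq'] at this
  exact add_left_cancel this

/-- Two equations are compared, using q_j - q_k = k - j + μ_j - μ_k. If y_j ≤ y_k for some j < k,
monotonicity of θ contradicts q_j > q_k. If y_j - y_k ≥ 2π, each of the n phases grows by at least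
2π and the linear term by at least 2πm, forcing q_j - q_k ≥ m + n, whereas membership in the grid
gives at most m + n - 1. -/
theorem IsBetheVector.mem_openAlcove {n m : ℕ} (hn : 1 ≤ n) (hm : 1 ≤ m) {t : ℝ} (ht : -1 < t)
    (ht' : t < 1) {μ ξ : Fin n → ℝ} (hμ : μ ∈ grid n m) (h : IsBetheVector m t μ ξ) :
    ξ ∈ openAlcove n (2 * Real.pi) := by
  obtain ⟨q, y, hq, hy, rfl⟩ := h
  rw [logBetheSystem_iff] at hy
  have hm' : (0 : ℝ) < m := by exact_mod_cast hm
  have hqd : ∀ j k, (q j : ℝ) - q k = (k : ℕ) - (j : ℕ) + (μ j - μ k) := fun j k => by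
    rw [← center_sub (fun j => (q j : ℝ)), hq]
    simp [rho]
    ring
  have hmono := (theta_strictMono ht ht').monotone
  refine ⟨center_mem_plane hn y, fun j k hjk => ?_, fun j k => ?_⟩
  · rw [← sub_pos, center_sub, sub_pos]
    by_contra! hle
    have h1 : ∑ l, theta t (y j - y l) ≤ ∑ l, theta t (y k - y l) :=
      Finset.sum_le_sum fun l _ => hmono (by linarith)
    have h2 := hy j
    have h3 := hy k
    have h4 := hqd j k
    have h5 : μ k ≤ μ j := hμ.2.2.1 hjk.le
    have h6 : ((j : ℕ) : ℝ) < (k : ℕ) := by exact_mod_cast hjk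
    have h7 : (0 : ℝ) < q j - q k := by linarith
    have h8 := mul_pos Real.two_pi_pos h7
    nlinarith
  · rw [center_sub]
    by_contra! hle
    have h1 : ∑ l, (theta t (y k - y l) + 2 * Real.pi) ≤ ∑ l, theta t (y j - y l) :=
      Finset.sum_le_sum fun l _ =>
        (theta_add_two_pi ht ht' _).trans (hmono (by linarith))
    rw [Finset.sum_add_distrib] at h1
    simp only [Finset.sum_const, Finset.card_univ, Fintype.card_fin, nsmul_eq_mul] at h1
    have h2 := hy j
    have h3 := hy k
    have h4 := hqd j k
    have h5 : μ j - μ k ≤ m := hμ.2.2.2 j k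
    have h6 : ((k : ℕ) : ℝ) + 1 ≤ n := by exact_mod_cast k.2
    have h7 : (0 : ℝ) ≤ (j : ℕ) := by positivity
    have h8 : (q j : ℝ) - q k ≤ m + n - 1 := by linarith
    have h9 := mul_le_mul_of_nonneg_left h8 Real.two_pi_pos.le
    have h10 := mul_le_mul_of_nonneg_left hle hm'.le
    nlinarith [Real.two_pi_pos]

/-! ### Plane waves and the algebraic Bethe equations. -/

theorem wave_add {n : ℕ} (a b x : Fin n → ℝ) : wave (a + b) x = wave a x * wave b x := by
  rw [wave, wave, wave, ← Complex.exp_add, add_dotProduct]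
  push_cast
  ring_nf

theorem wave_root {n : ℕ} (j k : Fin n) (x : Fin n → ℝ) :
    wave (root j k) x = Complex.exp (Complex.I * ((x j - x k : ℝ) : ℂ)) := by
  rw [wave, root_dotProduct]

theorem neg_root {n : ℕ} (j k : Fin n) : -root j k = root k j := by simp [root]

theorem norm_wave {n : ℕ} (a x : Fin n → ℝ) : ‖wave a x‖ = 1 := by
  rw [wave, mul_comm]; exact Complex.norm_exp_ofReal_mul_I _

theorem wave_root_mul {n : ℕ} (j k l : Fin n) (x : Fin n → ℝ) :
    wave (root j k) x * wave (root k l) x = wave (root j l) x := by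
  rw [← wave_add]; congr 1; simp [root]

theorem wave_root_self {n : ℕ} (j : Fin n) (x : Fin n → ℝ) : wave (root j j) x = 1 := by
  simp [wave_root]

theorem wave_root_center {n : ℕ} (j k : Fin n) (x : Fin n → ℝ) :
    wave (root j k) (center x) = wave (root j k) x := by
  rw [wave_root, wave_root, center_sub]

theorem wave_comp {n : ℕ} (a x : Fin n → ℝ) (σ : Equiv.Perm (Fin n)) :
    wave (a ∘ σ) (x ∘ σ) = wave a x := by
  rw [wave, wave, comp_equiv_dotProduct_comp_equiv]

theorem wave_root_comp {n : ℕ} (j k : Fin n) (x : Fin n → ℝ) (σ : Equiv.Perm (Fin n)) :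
    wave (root j k) (x ∘ σ) = wave (root (σ j) (σ k)) x := by
  rw [wave_root, wave_root]; rfl

theorem LogBetheSystem.exp_eq {n m : ℕ} {t : ℝ} (ht : -1 < t) (ht' : t < 1)
    {q : Fin n → ℤ} {y : Fin n → ℝ} (h : LogBetheSystem m t q y) (j : Fin n) :
    Complex.exp (Complex.I * ((m * y j : ℝ) : ℂ)) * ∏ l, (wave (root j l) y - t) =
      ∏ l, (1 - t * wave (root j l) y) := by
  rw [logBetheSystem_iff] at h
  have h1 : Complex.exp (Complex.I * ((m * y j : ℝ) : ℂ)) *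
      ∏ l, Complex.exp (Complex.I * (theta t (y j - y l) : ℂ)) = 1 := by
    rw [← Complex.exp_sum, ← Complex.exp_add, ← Finset.mul_sum, ← mul_add, ← Complex.ofReal_sum,
      ← Complex.ofReal_add, h j, Complex.exp_eq_one_iff]
    exact ⟨q j, by push_cast; ring⟩
  have h2 : ∏ l, (wave (root j l) y - t) =
      (∏ l, Complex.exp (Complex.I * (theta t (y j - y l) : ℂ))) *
        ∏ l, (1 - t * wave (root j l) y) := by
    rw [← Finset.prod_mul_distrib]
    refine Finset.prod_congr rfl fun l _ => ?_
    rw [wave_root, exp_theta ht ht']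
  rw [h2, ← mul_assoc, h1, one_mul]

/-- The roots at inner product 1 with e_j - e_k are e_j - e_l and e_l - e_k with l different from j
and k. -/
theorem prod_filter_root_dotProduct_eq_one {n : ℕ} {M : Type*} [CommMonoid M] {j k : Fin n}
    (hjk : j ≠ k) (F : Fin n × Fin n → M) :
    ∏ a ∈ (roots n).filter (fun a => root a.1 a.2 ⬝ᵥ root j k = 1), F a =
      (∏ l ∈ (Finset.univ.erase j).erase k, F (j, l)) *
        ∏ l ∈ (Finset.univ.erase j).erase k, F (l, k) := by
  classical
  set T := (Finset.univ.erase j).erase k with hT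
  have h : (roots n).filter (fun a => root a.1 a.2 ⬝ᵥ root j k = 1) =
      T.image (fun l => (j, l)) ∪ T.image (fun l => (l, k)) := by
    ext ⟨a, b⟩
    have h1 : (a, b) ∈ T.image (fun l => (j, l)) ↔ a = j ∧ b ≠ k ∧ b ≠ j := by
      simp [hT, Prod.ext_iff]; tauto
    have h2 : (a, b) ∈ T.image (fun l => (l, k)) ↔ b = k ∧ a ≠ k ∧ a ≠ j := by
      simp [hT, Prod.ext_iff]; tauto
    rw [Finset.mem_union, h1, h2]
    simp only [roots, Finset.mem_filter, Finset.mem_univ, true_and, root_dotProduct]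
    simp only [root, Pi.sub_apply, Pi.single_apply]
    by_cases h1 : a = j <;> by_cases h2 : a = k <;> by_cases h3 : b = j <;> by_cases h4 : b = k <;>
      simp [h1, h2, h3, h4] <;> grind
  rw [h, Finset.prod_union, Finset.prod_image, Finset.prod_image]
  · exact fun _ _ _ _ h => (Prod.ext_iff.1 h).1
  · exact fun _ _ _ _ h => (Prod.ext_iff.1 h).2
  · rw [Finset.disjoint_left]
    rintro ⟨a, b⟩ h1 h2
    simp only [Finset.mem_image, Prod.mk.injEq] at h1 h2
    obtain ⟨l, hl, rfl, rfl⟩ := h1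
    obtain ⟨l', hl', rfl, -⟩ := h2
    simp [hT] at hl'

/-- The exponentiated equation for j is divided by that for k. Because f j l and f l j are inverse
to each other, the denominators become factors f l k, and the pair j, k itself contributes the
square. -/
theorem LogBetheSystem.betheSystem {n m : ℕ} {t : ℝ} (ht : -1 < t) (ht' : t < 1)
    {q : Fin n → ℤ} {y : Fin n → ℝ} (h : LogBetheSystem m t q y) : BetheSystem m t (center y) := by
  rintro ⟨j, k⟩ hb
  have hjk : j ≠ k := by simpa [roots] using hb
  rw [prod_filter_root_dotProduct_eq_one hjk]
  simp only [wave_root_center]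
  let f : Fin n → Fin n → ℂ := fun j l => (1 - t * wave (root j l) y) / (wave (root j l) y - t)
  have hf0 : ∀ j l, f j l ≠ 0 := fun j l =>
    div_ne_zero (one_sub_mul_ne_zero ht ht' (norm_wave _ _))
      (sub_ne_zero_of_norm_one ht ht' (norm_wave _ _))
  have hsymm : ∀ j l, f l j * f j l = 1 := fun j l => by
    have h1 := one_sub_mul_ne_zero ht ht' (norm_wave (root j l) y)
    have h2 := sub_ne_zero_of_norm_one ht ht' (norm_wave (root j l) y)
    have h3 := sub_ne_zero_of_norm_one ht ht' (norm_wave (root l j) y)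
    have h4 := (wave_root_mul j l j y).trans (wave_root_self j y)
    simp only [f]
    field_simp
    linear_combination (t ^ 2 - 1) * h4
  have hone : ∀ j, f j j = 1 := fun j => by
    have : (1 : ℂ) - t ≠ 0 := sub_ne_zero_of_norm_one ht ht' (by simp)
    simp [f, wave_root_self, this]
  have hB : ∀ j, Complex.exp (Complex.I * ((m * y j : ℝ) : ℂ)) = ∏ l, f j l := fun j => by
    rw [Finset.prod_div_distrib, eq_div_iff, h.exp_eq ht ht']
    exact Finset.prod_ne_zero_iff.2 fun l _ => sub_ne_zero_of_norm_one ht ht' (norm_wave _ _)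
  have hsplit : ∀ G : Fin n → ℂ, ∏ l, G l =
      G j * G k * ∏ l ∈ (Finset.univ.erase j).erase k, G l := fun G => by
    rw [mul_assoc, Finset.mul_prod_erase _ _ (by simp [hjk.symm]),
      Finset.mul_prod_erase _ _ (Finset.mem_univ j)]
  have hm1 : wave (root j k) y ^ m * Complex.exp (Complex.I * ((m * y k : ℝ) : ℂ)) =
      Complex.exp (Complex.I * ((m * y j : ℝ) : ℂ)) := by
    rw [wave_root, ← Complex.exp_nat_mul, ← Complex.exp_add]
    push_cast
    ring_nf
  have hk0 : ∏ l, f k l ≠ 0 := Finset.prod_ne_zero_iff.2 fun l _ => hf0 _ _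
  rw [hB, hB] at hm1
  apply mul_right_cancel₀ hk0
  rw [hm1, hsplit (f j), hsplit (f k), hone, hone]
  have hinv : (∏ l ∈ (Finset.univ.erase j).erase k, f l k) *
      ∏ l ∈ (Finset.univ.erase j).erase k, f k l = 1 := by
    rw [← Finset.prod_mul_distrib]
    exact Finset.prod_eq_one fun l _ => hsymm _ _
  change 1 * f j k * (∏ l ∈ (Finset.univ.erase j).erase k, f j l) =
    f j k ^ 2 * ((∏ l ∈ (Finset.univ.erase j).erase k, f j l) *
      ∏ l ∈ (Finset.univ.erase j).erase k, f l k) *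
      (f k j * 1 * ∏ l ∈ (Finset.univ.erase j).erase k, f k l)
  linear_combination (-(f j k) * (∏ l ∈ (Finset.univ.erase j).erase k, f j l)) * hsymm j k +
    (-(f j k) ^ 2 * f k j * (∏ l ∈ (Finset.univ.erase j).erase k, f j l)) * hinv

/-- The Bethe equations in multiplicative form, for each particle separately and up to a common
factor. -/
def CyclicBetheSystem {n : ℕ} (m : ℕ) (t : ℝ) (ξ : Fin n → ℝ) : Prop :=
  ∃ z : ℂ, z ≠ 0 ∧ ∀ j, Complex.exp (Complex.I * (((m + n) * ξ j : ℝ) : ℂ)) *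
    ∏ l, (1 - t * wave (root l j) ξ) = z * ∏ l, (1 - t * wave (root j l) ξ)

theorem LogBetheSystem.cyclicBetheSystem {n m : ℕ} {t : ℝ} (ht : -1 < t) (ht' : t < 1)
    {q : Fin n → ℤ} {y : Fin n → ℝ} (h : LogBetheSystem m t q y) :
    CyclicBetheSystem m t (center y) := by
  -- The common factor records the mean of y removed by the projection. The extra n in the exponent
  -- arises from writing x - t = x(1 - t/x) for each of the n waves x.
  refine ⟨Complex.exp (Complex.I * ((-(m * ((∑ l, y l) / n)) : ℝ) : ℂ)), Complex.exp_ne_zero _,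
    fun j => ?_⟩
  have hn : (n : ℝ) ≠ 0 := by exact_mod_cast (Fin.pos j).ne'
  simp only [wave_root_center]
  rw [← h.exp_eq ht ht', ← mul_assoc, ← Complex.exp_add, ← mul_add, ← Complex.ofReal_add]
  have h1 : ∏ l, (wave (root j l) y - t) =
      Complex.exp (Complex.I * ((n * center y j : ℝ) : ℂ)) * ∏ l, (1 - t * wave (root l j) y) := by
    have h2 : Complex.exp (Complex.I * ((n * center y j : ℝ) : ℂ)) = ∏ l, wave (root j l) y := by
      simp only [wave_root]
      rw [← Complex.exp_sum, ← Finset.mul_sum, ← Complex.ofReal_sum]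
      congr 3
      simp [center]
      field_simp
    rw [h2, ← Finset.prod_mul_distrib]
    refine Finset.prod_congr rfl fun l _ => ?_
    linear_combination (t : ℂ) * ((wave_root_mul j l j y).trans (wave_root_self j y))
  rw [h1, ← mul_assoc, ← Complex.exp_add, ← mul_add, ← Complex.ofReal_add]
  congr 4
  simp only [center]
  ring

/-! ### The Bethe wave functions and their boundary conditions. -/

/-- The alternating sum of a function over the permutations of the components of `ξ`. -/
def alternate {n : ℕ} (G : (Fin n → ℝ) → ℂ) (ξ : Fin n → ℝ) : ℂ :=
  ∑ σ : Equiv.Perm (Fin n), ((Equiv.Perm.sign σ : ℤ) : ℂ) * G (ξ ∘ σ)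

theorem alternate_comp {n : ℕ} (G : (Fin n → ℝ) → ℂ) (c : Equiv.Perm (Fin n)) (ξ : Fin n → ℝ) :
    alternate (fun η => G (η ∘ c)) ξ = ((Equiv.Perm.sign c : ℤ) : ℂ) * alternate G ξ := by
  rw [alternate, alternate, Finset.mul_sum]
  nth_rewrite 2 [← Equiv.sum_comp (Equiv.mulRight c)]
  refine Finset.sum_congr rfl fun σ _ => ?_
  have h : (((Equiv.Perm.sign c : ℤ) : ℂ)) * ((Equiv.Perm.sign c : ℤ) : ℂ) = 1 := by
    rw [← Int.cast_mul, ← Units.val_mul, Int.units_mul_self]; simp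
  rw [Equiv.coe_mulRight, Equiv.Perm.sign_mul, Equiv.Perm.coe_mul, Function.comp_assoc]
  push_cast
  linear_combination (-((Equiv.Perm.sign σ : ℤ) : ℂ) * G (ξ ∘ σ ∘ c)) * h

theorem alternate_eq_zero {n : ℕ} {G : (Fin n → ℝ) → ℂ} {a b : Fin n} (hab : a ≠ b)
    (hG : ∀ η, G (η ∘ Equiv.swap a b) = G η) (ξ : Fin n → ℝ) : alternate G ξ = 0 := by
  have h := alternate_comp G (Equiv.swap a b) ξ
  simp only [hG] at h
  rw [Equiv.Perm.sign_swap hab] at h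
  simp only [Units.val_neg, Units.val_one, Int.cast_neg, Int.cast_one, neg_mul, one_mul] at h
  exact self_eq_neg.1 h

theorem alternate_add {n : ℕ} (G H : (Fin n → ℝ) → ℂ) (ξ : Fin n → ℝ) :
    alternate (fun η => G η + H η) ξ = alternate G ξ + alternate H ξ := by
  simp only [alternate, mul_add, Finset.sum_add_distrib]

theorem alternate_const_mul {n : ℕ} (z : ℂ) (G : (Fin n → ℝ) → ℂ) (ξ : Fin n → ℝ) :
    alternate (fun η => z * G η) ξ = z * alternate G ξ := by
  simp only [alternate, Finset.mul_sum, mul_left_comm]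

/-- The numerator of the Bethe Ansatz wave function, at an arbitrary real vector. -/
def betheNumerator {n : ℕ} (t : ℝ) (ξ l : Fin n → ℝ) : ℂ :=
  alternate (fun η => betheCoeff t η * wave (rho n + l) η) ξ

theorem betheWave_eq {n : ℕ} (t : ℝ) (l ξ : Fin n → ℝ) :
    betheWave t l ξ = (1 / weylDenominator ξ) * betheNumerator t ξ l := by
  simp only [betheWave, betheNumerator, alternate, mul_assoc]

theorem swap_lt_swap {n : ℕ} {a b : Fin n} (hab : (b : ℕ) = a + 1) {j k : Fin n} (h : j < k)
    (hne : (j, k) ≠ (a, b)) : Equiv.swap a b j < Equiv.swap a b k := by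
  have hne' : ¬ (j = a ∧ k = b) := fun h => hne (by rw [h.1, h.2])
  simp only [Equiv.swap_apply_def]
  simp only [Fin.ext_iff, Fin.lt_def] at *
  split_ifs <;> omega

/-- A simple reflection permutes the positive roots other than its own simple root, so only the
factor of that root fails to be symmetric. -/
theorem betheCoeff_swap {n : ℕ} (t : ℝ) {a b : Fin n} (hab : (b : ℕ) = a + 1) :
    ∃ A : (Fin n → ℝ) → ℂ, (∀ η, A (η ∘ Equiv.swap a b) = A η) ∧
      ∀ η, betheCoeff t η = A η * (1 - t * wave (root b a) η) := by
  have hlt : a < b := by rw [Fin.lt_def]; omega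
  refine ⟨fun η => ∏ p ∈ (posRoots n).erase (a, b), (1 - (t : ℂ) * wave (-root p.1 p.2) η),
    fun η => ?_, fun η => ?_⟩
  · refine Finset.prod_equiv ((Equiv.swap a b).prodCongr (Equiv.swap a b)) ?_ ?_
    · have key : ∀ p ∈ (posRoots n).erase (a, b),
          ((Equiv.swap a b).prodCongr (Equiv.swap a b)) p ∈ (posRoots n).erase (a, b) := by
        rintro ⟨j, k⟩ hp
        simp only [Finset.mem_erase, posRoots, Finset.mem_filter, Finset.mem_univ, true_and,
          Equiv.prodCongr_apply, Prod.map_apply] at hp ⊢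
        refine ⟨fun h => ?_, swap_lt_swap hab hp.2 hp.1⟩
        obtain ⟨h1, h2⟩ := Prod.ext_iff.1 h
        have h1' : j = b := (Equiv.swap a b).injective (h1.trans (Equiv.swap_apply_right a b).symm)
        have h2' : k = a := (Equiv.swap a b).injective (h2.trans (Equiv.swap_apply_left a b).symm)
        rw [h1', h2'] at hp
        exact absurd hp.2 hlt.not_gt
      intro p
      refine ⟨key p, fun h => ?_⟩
      have h1 := key _ h
      have h2 : Prod.map (Equiv.swap a b) (Equiv.swap a b)
          (Prod.map (Equiv.swap a b) (Equiv.swap a b) p) = p := by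
        rw [Prod.map_map, ← Equiv.Perm.coe_mul, Equiv.swap_mul_self]; rfl
      simp only [Equiv.prodCongr_apply, h2] at h1
      exact h1
    · rintro ⟨j, k⟩ -
      simp only [neg_root, wave_root_comp, Equiv.prodCongr_apply, Prod.map_apply]
  · rw [betheCoeff, ← neg_root]
    exact (Finset.prod_erase_mul _ _ (by simp [posRoots, hlt])).symm

/-- The boundary condition at a wall of the Weyl chamber. -/
theorem betheNumerator_swap {n : ℕ} (t : ℝ) (ξ : Fin n → ℝ) {a b : Fin n} (hab : (b : ℕ) = a + 1)
    {l : Fin n → ℝ} (hl : l b = l a + 1) :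
    betheNumerator t ξ l = t * betheNumerator t ξ (l ∘ Equiv.swap a b) := by
  obtain ⟨A, hA, hC⟩ := betheCoeff_swap t hab
  have hne : a ≠ b := fun h => by rw [h] at hab; omega
  have hne' := hne.symm
  -- The drop of ρ cancels the rise of l, so ρ + l is fixed by the transposition. The symmetric part
  -- G then alternates to zero, and the two remaining terms are exchanged with a sign.
  have hrho : rho n a = rho n b + 1 := by simp only [rho, hab]; push_cast; ring
  have hM : ∀ η, wave (rho n + l) (η ∘ Equiv.swap a b) = wave (rho n + l) η := fun η => by
    rw [← wave_comp (rho n + l) η (Equiv.swap a b)]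
    congr 1
    funext j
    simp only [Function.comp_apply, Equiv.swap_apply_def, Pi.add_apply]
    split_ifs with h1 h2
    · rw [h1]; linarith
    · rw [h2]; linarith
    · rfl
  have hM' : ∀ η, wave (rho n + l ∘ Equiv.swap a b) η = wave (rho n + l) η * wave (root a b) η :=
    fun η => by
    rw [← wave_add]
    congr 1
    funext j
    simp only [Function.comp_apply, Equiv.swap_apply_def, Pi.add_apply, root, Pi.sub_apply,
      Pi.single_apply]
    split_ifs with h1 h2 h2
    · exact absurd (h1.symm.trans h2) hne
    · rw [h1]; linarith
    · rw [h2]; linarith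
    · ring
  have hR : ∀ η, wave (root b a) (η ∘ Equiv.swap a b) = wave (root a b) η := fun η => by
    rw [wave_root_comp]; simp
  let G : (Fin n → ℝ) → ℂ := fun η => A η * wave (rho n + l) η
  have hG : ∀ η, G (η ∘ Equiv.swap a b) = G η := fun η => by simp only [G, hA, hM]
  have hG0 := alternate_eq_zero hne hG ξ
  have h1 : betheNumerator t ξ l = alternate G ξ +
      (-t) * alternate (fun η => G η * wave (root b a) η) ξ := by
    rw [← alternate_const_mul, ← alternate_add, betheNumerator]
    congr 1
    funext η
    simp only [hC, G]
    ring
  have h2 : betheNumerator t ξ (l ∘ Equiv.swap a b) =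
      alternate (fun η => G η * wave (root a b) η) ξ + (-t) * alternate G ξ := by
    rw [← alternate_const_mul, ← alternate_add, betheNumerator]
    congr 1
    funext η
    simp only [hC, G, hM']
    linear_combination (-t * A η * wave (rho n + l) η) *
      ((wave_root_mul b a b η).trans (wave_root_self b η))
  have h3 := alternate_comp (fun η => G η * wave (root b a) η) (Equiv.swap a b) ξ
  simp only [hG, hR] at h3
  rw [Equiv.Perm.sign_swap hne] at h3
  simp only [Units.val_neg, Units.val_one, Int.cast_neg, Int.cast_one, neg_mul, one_mul] at h3
  rw [h1, h2, hG0, h3]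
  ring

theorem sum_comp_perm {n : ℕ} (ξ : Fin n → ℝ) (σ : Equiv.Perm (Fin n)) :
    ∑ j, (ξ ∘ σ) j = ∑ j, ξ j := Equiv.sum_comp σ ξ

/-- Thanks to this invariance l + 1_S, which leaves the plane of sum zero, need not be projected
back. -/
theorem betheNumerator_add_const {n : ℕ} (t : ℝ) {ξ : Fin n → ℝ} (hξ : ξ ∈ plane n)
    (l : Fin n → ℝ) (c : ℝ) :
    betheNumerator t ξ (fun j => l j + c) = betheNumerator t ξ l := by
  have hξ' : ∑ j, ξ j = 0 := hξ
  simp only [betheNumerator, alternate]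
  refine Finset.sum_congr rfl fun σ _ => ?_
  have h : rho n + (fun j => l j + c) = (rho n + l) + fun _ => c := by
    funext j; simp only [Pi.add_apply]; ring
  have h1 : wave (fun _ : Fin n => c) (ξ ∘ σ) = 1 := by
    rw [wave, dotProduct, ← Finset.mul_sum, sum_comp_perm, hξ']
    simp
  rw [h, wave_add, h1, mul_one]

/-- The indicator vector of a set of coordinates. -/
def indic {n : ℕ} (S : Finset (Fin n)) : Fin n → ℝ := fun j => if j ∈ S then 1 else 0

/-- The elementary symmetric function of the plane waves. -/
def waveEsymm {n : ℕ} (r : ℕ) (ξ : Fin n → ℝ) : ℂ :=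
  ∑ S ∈ Finset.powersetCard r Finset.univ, wave (indic S) ξ

theorem waveEsymm_comp {n : ℕ} (r : ℕ) (ξ : Fin n → ℝ) (σ : Equiv.Perm (Fin n)) :
    waveEsymm r (ξ ∘ σ) = waveEsymm r ξ := by
  refine Finset.sum_equiv σ.finsetCongr (fun S => ?_) fun S _ => ?_
  · simp [Finset.mem_powersetCard]
  · rw [← wave_comp _ ξ σ]
    congr 1
    funext j
    simp [indic]

/-- The eigenvalue equation of the free Laplacians. -/
theorem sum_betheNumerator_add_indic {n : ℕ} (t : ℝ) (ξ l : Fin n → ℝ) (r : ℕ) :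
    ∑ S ∈ Finset.powersetCard r Finset.univ, betheNumerator t ξ (l + indic S) =
      waveEsymm r ξ * betheNumerator t ξ l := by
  simp only [betheNumerator, alternate]
  rw [Finset.sum_comm, Finset.mul_sum]
  refine Finset.sum_congr rfl fun σ _ => ?_
  rw [← waveEsymm_comp r ξ σ, waveEsymm, Finset.sum_mul]
  refine Finset.sum_congr rfl fun S _ => ?_
  rw [← add_assoc, wave_add]
  ring

theorem prod_posRoots_eq {n : ℕ} {M : Type*} [CommMonoid M] (F : Fin n × Fin n → M) :
    ∏ p ∈ posRoots n, F p = ∏ j, ∏ k, if j < k then F (j, k) else 1 := by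
  rw [posRoots, Finset.prod_filter, Fintype.prod_prod_type]

theorem prod_posRoots_succ {n : ℕ} {M : Type*} [CommMonoid M]
    (F : Fin (n + 1) × Fin (n + 1) → M) :
    ∏ p ∈ posRoots (n + 1), F p =
      (∏ j : Fin n, F (0, j.succ)) * ∏ p ∈ posRoots n, F (p.1.succ, p.2.succ) := by
  rw [prod_posRoots_eq, prod_posRoots_eq]
  simp [Fin.prod_univ_succ]

theorem prod_posRoots_castSucc {n : ℕ} {M : Type*} [CommMonoid M]
    (F : Fin (n + 1) × Fin (n + 1) → M) :
    ∏ p ∈ posRoots (n + 1), F p =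
      (∏ j : Fin n, F (j.castSucc, Fin.last n)) *
        ∏ p ∈ posRoots n, F (p.1.castSucc, p.2.castSucc) := by
  rw [prod_posRoots_eq, prod_posRoots_eq]
  simp [Fin.prod_univ_castSucc, Fin.castSucc_lt_last, Finset.prod_mul_distrib, mul_comm,
    (Fin.castSucc_lt_last _).not_gt]

/-- The generator of the cyclic symmetry of the dilated alcove. -/
def rot {n : ℕ} (m : ℕ) (l : Fin (n + 1) → ℝ) : Fin (n + 1) → ℝ :=
  Fin.cons (l (Fin.last n) + m) fun j => l j.castSucc

@[simp] theorem rot_zero {n : ℕ} (m : ℕ) (l : Fin (n + 1) → ℝ) :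
    rot m l 0 = l (Fin.last n) + m := rfl

@[simp] theorem rot_succ {n : ℕ} (m : ℕ) (l : Fin (n + 1) → ℝ) (j : Fin n) :
    rot m l j.succ = l j.castSucc := rfl

theorem CyclicBetheSystem.comp {n m : ℕ} {t : ℝ} {ξ : Fin n → ℝ} {z : ℂ}
    (h : ∀ j, Complex.exp (Complex.I * (((m + n) * ξ j : ℝ) : ℂ)) *
      ∏ l, (1 - t * wave (root l j) ξ) = z * ∏ l, (1 - t * wave (root j l) ξ))
    (σ : Equiv.Perm (Fin n)) (j : Fin n) :
    Complex.exp (Complex.I * (((m + n) * (ξ ∘ σ) j : ℝ) : ℂ)) *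
      ∏ l, (1 - t * wave (root l j) (ξ ∘ σ)) = z * ∏ l, (1 - t * wave (root j l) (ξ ∘ σ)) := by
  simp only [wave_root_comp]
  rw [Equiv.prod_comp σ fun l => 1 - (t : ℂ) * wave (root l (σ j)) ξ,
    Equiv.prod_comp σ fun l => 1 - (t : ℂ) * wave (root (σ j) l) ξ]
  exact h (σ j)

/-- The boundary condition at the affine wall, in the form of a cyclic quasi-invariance. -/
theorem betheNumerator_rot {n m : ℕ} {t : ℝ} (ht' : t < 1) {ξ : Fin (n + 1) → ℝ}
    (hξ : ξ ∈ plane (n + 1)) (hB : CyclicBetheSystem m t ξ) :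
    ∃ z : ℂ, z ≠ 0 ∧ ∀ l, betheNumerator t ξ (rot m l) = z * betheNumerator t ξ l := by
  obtain ⟨z, hz, hB⟩ := hB
  have hξ' : ∑ j, ξ j = 0 := hξ
  -- Reindexing the alternating sum by this cycle compares the two numerators term by term; the
  -- ratio of the σ-terms is constant by the Bethe equation of particle σ(last).
  let c : Equiv.Perm (Fin (n + 1)) := (finRotate (n + 1)).symm
  have hc0 : c 0 = Fin.last n := by
    simp only [c]; rw [Equiv.symm_apply_eq, finRotate_last]
  have hcs : ∀ j : Fin n, c j.succ = j.castSucc := fun j => by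
    simp only [c]; rw [Equiv.symm_apply_eq]; simp [finRotate_apply]
  have hs0 : ((Equiv.Perm.sign c : ℤ) : ℂ) ≠ 0 := by
    simp
  refine ⟨((Equiv.Perm.sign c : ℤ) : ℂ)⁻¹ * z, mul_ne_zero (inv_ne_zero hs0) hz, fun l => ?_⟩
  have h := alternate_comp (fun η => betheCoeff t η * wave (rho (n + 1) + rot m l) η) c ξ
  rw [eq_comm, ← eq_inv_mul_iff_mul_eq₀ hs0] at h
  rw [betheNumerator, h, mul_assoc, betheNumerator]
  congr 1
  rw [← alternate_const_mul]
  simp only [alternate]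
  refine Finset.sum_congr rfl fun σ _ => ?_
  congr 1
  set η := ξ ∘ σ with hη
  have hη0 : ∑ j, η j = 0 := by rw [hη, sum_comp_perm, hξ']
  have hE := CyclicBetheSystem.comp hB σ (Fin.last n)
  rw [← hη, Fin.prod_univ_castSucc, Fin.prod_univ_castSucc, wave_root_self] at hE
  have ht1 : (1 : ℂ) - t * 1 ≠ 0 := by
    rw [mul_one, sub_ne_zero]; exact_mod_cast ht'.ne'
  rw [← mul_assoc, ← mul_assoc] at hE
  have hE' := mul_right_cancel₀ ht1 hE
  -- The m comes from `rot`, n from the difference of the first and last entries of ρ, and 1 from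
  -- the unit drops of ρ at the other places combined with Σ η = 0.
  have hw : wave (rho (n + 1) + rot m l) (η ∘ c) = wave (rho (n + 1) + l) η *
      Complex.exp (Complex.I * (((m + (n + 1 : ℕ)) * η (Fin.last n) : ℝ) : ℂ)) := by
    rw [wave, wave, ← Complex.exp_add, ← mul_add, ← Complex.ofReal_add]
    congr 3
    rw [dotProduct, dotProduct, Fin.sum_univ_succ]
    rw [Fin.sum_univ_castSucc] at hη0 ⊢
    simp only [Function.comp_apply, hc0, hcs, Pi.add_apply, rot_zero, rot_succ, rho]
    have : ∑ j : Fin n, (((n + 1 : ℕ) : ℝ) - 1) / 2 * η j.castSucc =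
      (((n + 1 : ℕ) : ℝ) - 1) / 2 * (- η (Fin.last n)) := by
      rw [← Finset.mul_sum]; congr 1; linarith
    have h3 : ∑ j : Fin n, ((((n + 1 : ℕ) : ℝ) - 1) / 2 - ((j.succ : Fin (n + 1)) : ℕ) + l j.castSucc)
        * η j.castSucc = (∑ j : Fin n, ((((n + 1 : ℕ) : ℝ) - 1) / 2 -
          ((j.castSucc : Fin (n + 1)) : ℕ) + l j.castSucc) * η j.castSucc) + η (Fin.last n) := by
      rw [← sub_eq_iff_eq_add', ← Finset.sum_sub_distrib]
      rw [show η (Fin.last n) = - ∑ j : Fin n, η j.castSucc by linarith, ← Finset.sum_neg_distrib]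
      refine Finset.sum_congr rfl fun j _ => ?_
      simp
      ring
    rw [h3]
    simp
    ring
  rw [hw, betheCoeff, betheCoeff, prod_posRoots_succ, prod_posRoots_castSucc]
  simp only [neg_root, wave_root_comp, hc0, hcs]
  linear_combination (wave (rho (n + 1) + l) η *
    ∏ p ∈ posRoots n, (1 - (t : ℂ) * wave (root p.2.castSucc p.1.castSucc) η)) * hE'

/-! ### The Weyl denominator and Hall–Littlewood polynomials. -/

theorem half_sum_posRoots {n : ℕ} (x : Fin n → ℝ) :
    ∑ p ∈ posRoots n, (x p.1 - x p.2) / 2 = ∑ j, rho n j * x j := by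
  have h : ∑ p ∈ posRoots n, (x p.1 - x p.2) / 2 =
      ∑ j, ∑ k, (if j < k then x j / 2 else 0) - ∑ k, ∑ j, (if j < k then x k / 2 else 0) := by
    rw [posRoots, Finset.sum_filter, Fintype.sum_prod_type, Finset.sum_comm (f := fun k j =>
      if j < k then x k / 2 else 0), ← Finset.sum_sub_distrib]
    refine Finset.sum_congr rfl fun j _ => ?_
    rw [← Finset.sum_sub_distrib]
    refine Finset.sum_congr rfl fun k _ => ?_
    split_ifs <;> ring
  rw [h, ← Finset.sum_sub_distrib]
  refine Finset.sum_congr rfl fun j _ => ?_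
  rw [← Finset.sum_filter, ← Finset.sum_filter, Finset.sum_const, Finset.sum_const,
    Finset.filter_lt_eq_Ioi, Finset.filter_gt_eq_Iio, Fin.card_Ioi, Fin.card_Iio, rho]
  have : (j : ℕ) ≤ n - 1 := by omega
  have h1 : 1 ≤ n := by omega
  simp only [nsmul_eq_mul]
  rw [Nat.cast_sub this, Nat.cast_sub h1]
  push_cast
  ring

theorem weylDenominator_eq {n : ℕ} (ξ : Fin n → ℝ) :
    weylDenominator ξ = wave (rho n) ξ * ∏ p ∈ posRoots n, (1 - wave (-root p.1 p.2) ξ) := by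
  have h : wave (rho n) ξ = ∏ p ∈ posRoots n, wave ((1 / 2 : ℝ) • root p.1 p.2) ξ := by
    rw [wave, dotProduct, ← half_sum_posRoots, Complex.ofReal_sum, Finset.mul_sum, Complex.exp_sum]
    refine Finset.prod_congr rfl fun p _ => ?_
    rw [wave, smul_dotProduct, root_dotProduct, smul_eq_mul]
    congr 3
    ring
  rw [h, weylDenominator, ← Finset.prod_mul_distrib]
  refine Finset.prod_congr rfl fun p _ => ?_
  rw [mul_sub, mul_one, ← wave_add]
  congr 2
  rw [← sub_eq_add_neg]
  funext j
  simp only [Pi.neg_apply, Pi.sub_apply, Pi.smul_apply, smul_eq_mul]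
  ring

theorem weylDenominator_comp {n : ℕ} (ξ : Fin n → ℝ) (σ : Equiv.Perm (Fin n)) :
    weylDenominator (ξ ∘ σ) = ((Equiv.Perm.sign σ : ℤ) : ℂ) * weylDenominator ξ := by
  let f : Fin n → Fin n → ℂ := fun j k =>
    wave ((1 / 2 : ℝ) • root j k) ξ - wave (-((1 / 2 : ℝ) • root j k)) ξ
  have hf : ∀ j k, f j k = -f k j := fun j k => by
    simp only [f, ← smul_neg, neg_root]
    ring
  have h := Equiv.Perm.prod_Ioi_comp_eq_sign_mul_prod σ hf
  have hs : ∀ F : Fin n → Fin n → ℂ, ∏ p ∈ posRoots n, F p.1 p.2 =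
      ∏ j, ∏ k ∈ Finset.Ioi j, F j k := fun F => by
    rw [prod_posRoots_eq fun p => F p.1 p.2]
    refine Finset.prod_congr rfl fun j _ => ?_
    rw [← Finset.prod_filter, Finset.filter_lt_eq_Ioi]
  have h1 : weylDenominator (ξ ∘ σ) = ∏ p ∈ posRoots n, f (σ p.1) (σ p.2) := by
    refine Finset.prod_congr rfl fun p _ => ?_
    simp only [f, wave, neg_dotProduct, smul_dotProduct, root_dotProduct, Function.comp_apply]
  rw [h1, hs fun j k => f (σ j) (σ k), h, ← hs f]
  rfl

theorem wave_root_ne_one {n : ℕ} {ξ : Fin n → ℝ} (hξ : ξ ∈ openAlcove n (2 * Real.pi))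
    {j k : Fin n} (hjk : j ≠ k) : wave (root j k) ξ ≠ 1 := by
  intro h
  rw [wave_root, Complex.exp_eq_one_iff] at h
  obtain ⟨z, hz⟩ := h
  have hz' : ξ j - ξ k = z * (2 * Real.pi) := by
    have : ((ξ j - ξ k : ℝ) : ℂ) = z * (2 * Real.pi) := by
      apply mul_left_cancel₀ Complex.I_ne_zero
      rw [hz]; ring
    exact_mod_cast this
  have h1 := hξ.2.2 j k
  have h2 := hξ.2.2 k j
  have hpi := Real.two_pi_pos
  have h3 : (z : ℝ) < 1 := by by_contra! h; nlinarith
  have h4 : (-1 : ℝ) < z := by by_contra! h; nlinarith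
  have h5 : z < 1 := by exact_mod_cast h3
  have h6 : -1 < z := by exact_mod_cast h4
  have h7 : z = 0 := by omega
  rw [h7, Int.cast_zero, zero_mul, sub_eq_zero] at hz'
  exact hjk (hξ.2.1.injective hz')

theorem weylDenominator_ne_zero {n : ℕ} {ξ : Fin n → ℝ} (hξ : ξ ∈ openAlcove n (2 * Real.pi)) :
    weylDenominator ξ ≠ 0 := by
  rw [weylDenominator_eq]
  refine mul_ne_zero (Complex.exp_ne_zero _) (Finset.prod_ne_zero_iff.2 fun p hp => ?_)
  have hp' : p.1 < p.2 := by simpa [posRoots] using hp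
  rw [neg_root, sub_ne_zero]
  exact (wave_root_ne_one hξ hp'.ne').symm

/-- The summands agree one by one: antisymmetry of the Weyl denominator absorbs the sign of σ, and
its factorization removes the wave of ρ. -/
theorem betheWave_eq_hallLittlewood {n : ℕ} (t : ℝ) (l : Fin n → ℝ) {ξ : Fin n → ℝ}
    (hξ : ξ ∈ openAlcove n (2 * Real.pi)) : betheWave t l ξ = hallLittlewood t l ξ := by
  rw [betheWave, hallLittlewood, Finset.mul_sum]
  refine Finset.sum_congr rfl fun σ _ => ?_
  have hδ := weylDenominator_ne_zero hξ
  have h1 := weylDenominator_comp ξ σ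
  have hs : ((Equiv.Perm.sign σ : ℤ) : ℂ) * ((Equiv.Perm.sign σ : ℤ) : ℂ) = 1 := by
    rw [← Int.cast_mul, ← Units.val_mul, Int.units_mul_self]; simp
  have hs0 := left_ne_zero_of_mul_eq_one hs
  have hδ' := mul_ne_zero hs0 hδ
  have h2 := h1.symm.trans (weylDenominator_eq (ξ ∘ σ))
  rw [h2] at hδ'
  have hP := right_ne_zero_of_mul hδ'
  rw [Finset.prod_div_distrib, wave_add, betheCoeff]
  rw [one_div, inv_mul_eq_iff_eq_mul₀ hδ]
  rw [div_mul_eq_mul_div, mul_div_assoc', eq_div_iff hP]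
  linear_combination (-((Equiv.Perm.sign σ : ℤ) : ℂ) *
    (∏ p ∈ posRoots n, (1 - (t : ℂ) * wave (-root p.1 p.2) (ξ ∘ σ))) * wave l (ξ ∘ σ)) * h2 +
    ((∏ p ∈ posRoots n, (1 - (t : ℂ) * wave (-root p.1 p.2) (ξ ∘ σ))) * wave l (ξ ∘ σ) *
      weylDenominator ξ) * hs

/-! ### Nonvanishing at the origin of the grid. -/

-- The polynomial R = ∏(X - t x_j) - ∏(X - x_j) has degree below the number of nodes, since the
-- leading terms cancel. Lagrange interpolation at the nodes x_a, evaluated at 0, is the identity up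
-- to the factor ∏(-x_j).
open Polynomial in
theorem sum_prod_sub_mul_div_sub {ι F : Type*} [Fintype ι] [DecidableEq ι] [Field F] (t : F)
    {x : ι → F} (hx : Function.Injective x) (hx0 : ∀ i, x i ≠ 0) :
    (1 - t) * ∑ a, ∏ j ∈ Finset.univ.erase a, (x a - t * x j) / (x a - x j) =
      1 - t ^ Fintype.card ι := by
  rcases isEmpty_or_nonempty ι with hι | hι
  · simp
  let R : F[X] := ∏ j, (X - C (t * x j)) - ∏ j, (X - C (x j))
  have hdeg : R.degree < (Finset.univ : Finset ι).card := by
    have h1 := degree_prod_of_monic (Finset.univ : Finset ι) (fun j => X - C (t * x j))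
      fun j _ => monic_X_sub_C _
    have h2 := degree_prod_of_monic (Finset.univ : Finset ι) (fun j => X - C (x j))
      fun j _ => monic_X_sub_C _
    simp only [degree_X_sub_C, Finset.sum_const, nsmul_eq_mul, mul_one] at h1 h2
    rw [← h1]
    refine degree_sub_lt_left (h1.trans h2.symm)
      (monic_prod_of_monic _ _ fun j _ => monic_X_sub_C _).ne_zero ?_
    rw [(monic_prod_of_monic _ _ fun j _ => monic_X_sub_C _).leadingCoeff,
      (monic_prod_of_monic _ _ fun j _ => monic_X_sub_C _).leadingCoeff]
  have hev : ∀ a ∈ (Finset.univ : Finset ι), R.eval (x a) =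
      (1 - t) * x a * ∏ j ∈ Finset.univ.erase a, (x a - t * x j) := fun a _ => by
    have h0 : ∏ j, (x a - x j) = 0 := Finset.prod_eq_zero (Finset.mem_univ a) (sub_self _)
    simp only [R, eval_sub, eval_prod, eval_X, eval_C, h0, sub_zero]
    rw [← Finset.mul_prod_erase _ _ (Finset.mem_univ a)]
    ring
  have hR := Lagrange.eq_interpolate_of_eval_eq (s := Finset.univ) (v := x) _ hx.injOn hdeg hev
  have h0 := congrArg (eval 0) hR
  rw [Lagrange.interpolate_apply, eval_finsetSum] at h0
  simp only [R, eval_sub, eval_prod, eval_X, eval_C, zero_sub, eval_mul, Lagrange.basis,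
    Lagrange.basisDivisor] at h0
  have hp : (∏ j, -x j) ≠ 0 := Finset.prod_ne_zero_iff.2 fun j _ => neg_ne_zero.2 (hx0 j)
  have hl : ∏ j, -(t * x j) = t ^ Fintype.card ι * ∏ j, -x j := by
    simp only [← mul_neg, Finset.prod_mul_distrib, Finset.prod_const, Finset.card_univ]
  rw [hl] at h0
  apply mul_right_cancel₀ hp
  have hneg : (1 - t ^ Fintype.card ι) * ∏ j, -x j =
      -(t ^ Fintype.card ι * ∏ j, -x j - ∏ j, -x j) := by ring
  rw [hneg, h0, Finset.mul_sum, Finset.sum_mul, ← Finset.sum_neg_distrib]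
  refine Finset.sum_congr rfl fun a _ => ?_
  rw [Finset.prod_div_distrib, Finset.prod_mul_distrib, Finset.prod_inv_distrib,
    ← Finset.mul_prod_erase _ (fun j => -x j) (Finset.mem_univ a)]
  ring

/-- The Poincaré polynomial of the symmetric group as a symmetrization. -/
theorem sum_perm_prod_posRoots {F : Type*} [Field F] (t : F) (n : ℕ) (x : Fin n → F)
    (hx : Function.Injective x) (hx0 : ∀ i, x i ≠ 0) :
    (1 - t) ^ n * ∑ σ : Equiv.Perm (Fin n), ∏ p ∈ posRoots n,
      (x (σ p.1) - t * x (σ p.2)) / (x (σ p.1) - x (σ p.2)) =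
      ∏ j ∈ Finset.range n, (1 - t ^ (j + 1)) := by
  induction n with
  | zero => simp [posRoots]
  | succ n ih =>
    let f : F → F → F := fun a b => (a - t * b) / (a - b)
    -- Permutations are grouped by a = σ(0). The pairs involving 0 give a product that depends only
    -- on a, and the other pairs give the statement for the remaining n variables. The sum over a is
    -- then `sum_prod_sub_mul_div_sub`.
    have hstep : ∀ a : Fin (n + 1), (1 - t) ^ n * ∑ e : Equiv.Perm (Fin n),
        ∏ p ∈ posRoots (n + 1), f (x (Equiv.Perm.decomposeFin.symm (a, e) p.1))
          (x (Equiv.Perm.decomposeFin.symm (a, e) p.2)) =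
        (∏ j ∈ Finset.range n, (1 - t ^ (j + 1))) * ∏ j ∈ Finset.univ.erase a, f (x a) (x j) := by
      intro a
      let x' : Fin n → F := fun j => x (Equiv.swap 0 a j.succ)
      have hx' : Function.Injective x' :=
        hx.comp ((Equiv.swap 0 a).injective.comp (Fin.succ_injective n))
      have h := ih x' hx' fun i => hx0 _
      have he : ∏ j ∈ Finset.univ.erase a, f (x a) (x j) = ∏ j : Fin n, f (x a) (x' j) := by
        have h1 : Finset.univ.erase a =
            (Finset.univ : Finset (Fin n)).image fun j => Equiv.swap 0 a j.succ := by
          ext b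
          simp only [Finset.mem_erase, Finset.mem_univ, and_true, Finset.mem_image, true_and]
          constructor
          · intro hb
            have : Equiv.swap 0 a b ≠ 0 := fun h0 => hb (by
              have := congrArg (Equiv.swap 0 a) h0
              simpa using this)
            obtain ⟨j, hj⟩ := Fin.exists_succ_eq.2 this
            exact ⟨j, by rw [hj, Equiv.swap_apply_self]⟩
          · rintro ⟨j, rfl⟩ h0
            have := congrArg (Equiv.swap 0 a) h0
            simp at this
        rw [h1, Finset.prod_image fun i _ j _ hij =>
          Fin.succ_injective n ((Equiv.swap 0 a).injective hij)]
      rw [← h, mul_assoc, Finset.sum_mul]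
      congr 1
      refine Finset.sum_congr rfl fun e _ => ?_
      rw [prod_posRoots_succ, he, mul_comm]
      simp only [Equiv.Perm.decomposeFin_symm_apply_zero, Equiv.Perm.decomposeFin_symm_apply_succ]
      congr 1
      exact Equiv.prod_comp e fun j => f (x a) (x' j)
    have h1 := sum_prod_sub_mul_div_sub t hx hx0
    rw [Fintype.card_fin] at h1
    rw [← Equiv.sum_comp Equiv.Perm.decomposeFin.symm, Fintype.sum_prod_type, pow_succ', mul_assoc,
      Finset.mul_sum, Finset.sum_congr rfl fun a _ => hstep a, ← Finset.mul_sum,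
      Finset.prod_range_succ, ← h1]
    ring

theorem hallLittlewood_zero_ne_zero {n : ℕ} {t : ℝ} (ht : -1 < t) (ht' : t < 1) {ξ : Fin n → ℝ}
    (hξ : ξ ∈ openAlcove n (2 * Real.pi)) : hallLittlewood t 0 ξ ≠ 0 := by
  let x : Fin n → ℂ := fun j => Complex.exp (Complex.I * (ξ j : ℂ))
  have hx0 : ∀ j, x j ≠ 0 := fun j => Complex.exp_ne_zero _
  have hr : ∀ j k, wave (root j k) ξ = x j / x k := fun j k => by
    simp only [wave_root, x]
    rw [← Complex.exp_sub]
    push_cast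
    ring_nf
  have hx : Function.Injective x := fun j k hjk => by
    by_contra hne
    refine wave_root_ne_one hξ hne ?_
    rw [hr, hjk, div_self (hx0 k)]
  have h := sum_perm_prod_posRoots (t : ℂ) n x hx hx0
  have h1 : hallLittlewood t 0 ξ = ∑ σ : Equiv.Perm (Fin n), ∏ p ∈ posRoots n,
      (x (σ p.1) - t * x (σ p.2)) / (x (σ p.1) - x (σ p.2)) := by
    refine Finset.sum_congr rfl fun σ _ => ?_
    have hw : wave (0 : Fin n → ℝ) (ξ ∘ σ) = 1 := by simp [wave]
    rw [hw, mul_one]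
    refine Finset.prod_congr rfl fun p _ => ?_
    rw [neg_root, wave_root_comp, hr, ← mul_div_mul_right _ _ (hx0 (σ p.1))]
    congr 1 <;> field_simp [hx0 (σ p.1)]
  rw [h1]
  refine right_ne_zero_of_mul (a := (1 - (t : ℂ)) ^ n) ?_
  rw [h]
  refine Finset.prod_ne_zero_iff.2 fun j _ => ?_
  have : t ^ (j + 1) ≠ 1 := by
    intro h
    have := pow_lt_one₀ (abs_nonneg t) (abs_lt.2 ⟨ht, ht'⟩) (Nat.succ_ne_zero j)
    rw [← abs_pow, h, abs_one] at this
    exact lt_irrefl _ this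
  rw [sub_ne_zero]
  exact_mod_cast this.symm

/-! ### Gaussian binomials, colored inversions and the weight as a quotient of factorials. -/

/-- The `t`-integer `1 + t + ⋯ + t^(j-1)`. -/
def qInt (t : ℝ) (j : ℕ) : ℝ := (1 - t ^ j) / (1 - t)

/-- The `t`-factorial. -/
def qFact (t : ℝ) (n : ℕ) : ℝ := ∏ i ∈ Finset.range n, qInt t (i + 1)

/-- The Gaussian binomial coefficient. -/
def qBinom (t : ℝ) : ℕ → ℕ → ℝ
  | _, 0 => 1
  | 0, _ + 1 => 0
  | N + 1, k + 1 => qBinom t N (k + 1) + t ^ (N - k) * qBinom t N k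

theorem qBinom_zero (t : ℝ) (N : ℕ) : qBinom t N 0 = 1 := by cases N <;> rfl

theorem qBinom_succ_succ (t : ℝ) (N k : ℕ) :
    qBinom t (N + 1) (k + 1) = qBinom t N (k + 1) + t ^ (N - k) * qBinom t N k := rfl

theorem qBinom_eq_zero (t : ℝ) {N k : ℕ} (h : N < k) : qBinom t N k = 0 := by
  induction N generalizing k with
  | zero => obtain ⟨k, rfl⟩ := Nat.exists_eq_succ_of_ne_zero h.ne'; rfl
  | succ N ih =>
    obtain ⟨k, rfl⟩ := Nat.exists_eq_succ_of_ne_zero (show k ≠ 0 by omega)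
    rw [Nat.succ_eq_add_one, qBinom_succ_succ, ih (by omega), ih (by omega)]
    simp

theorem qFact_succ (t : ℝ) (n : ℕ) : qFact t (n + 1) = qFact t n * qInt t (n + 1) :=
  Finset.prod_range_succ _ _

theorem qBinom_mul (t : ℝ) {N k : ℕ} (h : k ≤ N) :
    qBinom t N k * (qFact t k * qFact t (N - k)) = qFact t N := by
  induction N generalizing k with
  | zero =>
    obtain rfl : k = 0 := by omega
    simp [qBinom_zero, qFact]
  | succ N ih =>
    rcases k with _ | k
    · simp [qBinom_zero, qFact]
    have h2 := ih (show k ≤ N by omega)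
    have hq : qInt t (N + 1) = qInt t (N - k) + t ^ (N - k) * qInt t (k + 1) := by
      have : t ^ (N + 1) = t ^ (N - k) * t ^ (k + 1) := by rw [← pow_add]; congr 1; omega
      rw [qInt, qInt, qInt, this]
      ring
    rw [qBinom_succ_succ, Nat.add_sub_add_right, qFact_succ, qFact_succ, hq]
    -- For k = N the truncated difference N - (k + 1) would be meaningless, but then the first term
    -- of the recurrence and the integer [N - k] both vanish.
    rcases eq_or_lt_of_le (show k ≤ N by omega) with rfl | hlt
    · rw [qBinom_eq_zero t (Nat.lt_succ_self k)]
      have h0 : qInt t (k - k) = 0 := by simp [qInt]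
      rw [h0]
      linear_combination (t ^ (k - k) * qInt t (k + 1)) * h2
    · have h1 := ih (show k + 1 ≤ N by omega)
      obtain ⟨d, hd⟩ : ∃ d, N - k = d + 1 := ⟨N - k - 1, by omega⟩
      have hd' : N - (k + 1) = d := by omega
      rw [hd', qFact_succ] at h1
      rw [hd, qFact_succ] at h2 ⊢
      linear_combination qInt t (d + 1) * h1 + (t ^ (d + 1) * qInt t (k + 1)) * h2

section Colors

variable {ι C : Type*} [LinearOrder ι] [DecidableEq C]

/-- The number of elements of a given color. -/
def colorCount (κ : ι → C) (S : Finset ι) (c : C) : ℕ := (S.filter fun j => κ j = c).card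

/-- The number of inversions between elements of the same color. -/
def colorInv (κ : ι → C) (X S : Finset ι) : ℕ :=
  ((X ×ˢ X).filter fun p => p.1 < p.2 ∧ κ p.1 = κ p.2 ∧ p.1 ∉ S ∧ p.2 ∈ S).card

theorem colorCount_insert (κ : ι → C) {X : Finset ι} {j : ι} (hj : j ∉ X) (c : C) :
    colorCount κ (insert j X) c = colorCount κ X c + if c = κ j then 1 else 0 := by
  rw [colorCount, colorCount, Finset.filter_insert]
  by_cases h : κ j = c
  · rw [if_pos h, if_pos h.symm, Finset.card_insert_of_notMem (by simp [hj])]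
  · rw [if_neg h, if_neg (Ne.symm h), add_zero]

theorem colorInv_insert_right (κ : ι → C) {X S : Finset ι} {j : ι} (hj : ∀ i ∈ X, i < j)
    (hS : S ⊆ X) : colorInv κ (insert j X) S = colorInv κ X S := by
  rw [colorInv, colorInv]
  congr 1
  ext ⟨a, b⟩
  simp only [Finset.mem_filter, Finset.mem_product, Finset.mem_insert]
  constructor
  · rintro ⟨⟨ha, -⟩, hab, h1, h2, h3⟩
    have hb := hS h3
    refine ⟨⟨ha.resolve_left fun h => ?_, hb⟩, hab, h1, h2, h3⟩
    exact absurd (hj b hb) (by rw [← h]; exact hab.not_gt)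
  · rintro ⟨⟨ha, hb⟩, h⟩
    exact ⟨⟨Or.inr ha, Or.inr hb⟩, h⟩

/-- The new largest element, placed in the subset, forms an inversion with each element of its color
outside S and creates no other. -/
theorem colorInv_insert (κ : ι → C) {X S : Finset ι} {j : ι} (hj : ∀ i ∈ X, i < j)
    (hS : S ⊆ X) : colorInv κ (insert j X) (insert j S) =
      colorInv κ X S + (colorCount κ X (κ j) - colorCount κ S (κ j)) := by
  have hc : colorCount κ X (κ j) - colorCount κ S (κ j) =
      (((X \ S).filter fun i => κ i = κ j).image fun i => (i, j)).card := by
    rw [Finset.card_image_of_injective _ fun _ _ h => (Prod.ext_iff.1 h).1, colorCount, colorCount, ← Finset.card_sdiff_of_subset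
      (Finset.filter_subset_filter _ hS)]
    congr 1
    ext i
    simp only [Finset.mem_sdiff, Finset.mem_filter]
    tauto
  rw [hc, colorInv, colorInv, ← Finset.card_union_of_disjoint]
  · congr 1
    have hjX : j ∉ X := fun h => lt_irrefl _ (hj j h)
    ext ⟨a, b⟩
    simp only [Finset.mem_filter, Finset.mem_product, Finset.mem_insert, Finset.mem_union,
      Finset.mem_image, Finset.mem_sdiff, Prod.mk.injEq]
    constructor
    · rintro ⟨⟨ha, hb⟩, hab, h1, h2, h3⟩
      push Not at h2
      have haX : a ∈ X := ha.resolve_left h2.1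
      rcases h3 with rfl | h3
      · exact Or.inr ⟨a, ⟨⟨haX, h2.2⟩, h1⟩, rfl, rfl⟩
      · exact Or.inl ⟨⟨haX, hS h3⟩, hab, h1, h2.2, h3⟩
    · rintro (⟨⟨ha, hb⟩, hab, h1, h2, h3⟩ | ⟨i, ⟨⟨hi, hiS⟩, hκ⟩, rfl, rfl⟩)
      · refine ⟨⟨Or.inr ha, Or.inr hb⟩, hab, h1, ?_, Or.inr h3⟩
        rintro (rfl | h)
        · exact hjX ha
        · exact h2 h
      · refine ⟨⟨Or.inr hi, Or.inl rfl⟩, hj _ hi, hκ, ?_, Or.inl rfl⟩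
        rintro (rfl | h)
        · exact hjX hi
        · exact hiS h
  · rw [Finset.disjoint_left]
    rintro ⟨a, b⟩ h1 h2
    simp only [Finset.mem_filter, Finset.mem_product, Finset.mem_image,
      Prod.mk.injEq] at h1 h2
    obtain ⟨i, -, -, rfl⟩ := h2
    exact lt_irrefl _ (hj _ h1.1.2)

open Classical in
/-- The Gaussian binomial theorem: the inversion statistic on the subsets with a given number of
elements of every color. -/
theorem sum_pow_colorInv (t : ℝ) (κ : ι → C) (X : Finset ι) (C₀ : Finset C)
    (hC : ∀ j ∈ X, κ j ∈ C₀) (k : C → ℕ) (hk : ∀ c, c ∉ C₀ → k c = 0) :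
    ∑ S ∈ X.powerset, (if colorCount κ S = k then t ^ colorInv κ X S else 0) =
      ∏ c ∈ C₀, qBinom t (colorCount κ X c) (k c) := by
  induction X using Finset.induction_on_max generalizing k with
  | empty =>
    rw [Finset.powerset_empty, Finset.sum_singleton]
    split_ifs with h
    · have : ∀ c, k c = 0 := fun c => by rw [← h]; simp [colorCount]
      simp [colorInv, this, qBinom_zero]
    · obtain ⟨c, hc⟩ := Function.ne_iff.1 h
      have hc0 : k c ≠ 0 := fun h0 => hc (by rw [h0]; simp [colorCount])
      refine (Finset.prod_eq_zero (i := c) ?_ ?_).symm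
      · by_contra hcC
        exact hc0 (hk c hcC)
      · exact qBinom_eq_zero t (by simpa [colorCount] using Nat.pos_of_ne_zero hc0)
  | insert j X hj ih =>
    have hjX : j ∉ X := fun h => lt_irrefl _ (hj j h)
    have hC' : ∀ i ∈ X, κ i ∈ C₀ := fun i hi => hC i (Finset.mem_insert_of_mem hi)
    have hcj : κ j ∈ C₀ := hC j (Finset.mem_insert_self _ _)
    have hsplit : ∀ k' : C → ℕ, (∀ c ≠ κ j, k' c = k c) →
        ∏ c ∈ C₀, qBinom t (colorCount κ X c) (k' c) = qBinom t (colorCount κ X (κ j)) (k' (κ j)) *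
          ∏ c ∈ C₀.erase (κ j), qBinom t (colorCount κ X c) (k c) := fun k' hk' => by
      rw [← Finset.mul_prod_erase _ _ hcj]
      congr 1
      exact Finset.prod_congr rfl fun c hc => by rw [hk' c (Finset.ne_of_mem_erase hc)]
    have hR : ∏ c ∈ C₀, qBinom t (colorCount κ (insert j X) c) (k c) =
        qBinom t (colorCount κ X (κ j) + 1) (k (κ j)) *
          ∏ c ∈ C₀.erase (κ j), qBinom t (colorCount κ X c) (k c) := by
      rw [← Finset.mul_prod_erase _ _ hcj, colorCount_insert κ hjX, if_pos rfl]
      congr 1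
      exact Finset.prod_congr rfl fun c hc => by
        rw [colorCount_insert κ hjX, if_neg (Finset.ne_of_mem_erase hc), add_zero]
    have h1 : ∑ S ∈ X.powerset, (if colorCount κ S = k then t ^ colorInv κ (insert j X) S else 0) =
        ∏ c ∈ C₀, qBinom t (colorCount κ X c) (k c) := by
      rw [← ih hC' k hk]
      refine Finset.sum_congr rfl fun S hS => ?_
      rw [colorInv_insert_right κ hj (Finset.mem_powerset.1 hS)]
    have hins : ∀ S ∈ X.powerset, ∀ c, colorCount κ (insert j S) c =
        colorCount κ S c + if c = κ j then 1 else 0 := fun S hS c =>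
      colorCount_insert κ (fun h => hjX (Finset.mem_powerset.1 hS h)) c
    -- Subsets without the largest element j and subsets with it produce the two terms of the
    -- recurrence of `qBinom` for the color of j; other colors are unaffected.
    rw [Finset.sum_powerset_insert hjX, h1, hR]
    rcases hkj : k (κ j) with _ | d
    · rw [Finset.sum_eq_zero, add_zero, hsplit k fun _ _ => rfl, hkj, qBinom_zero, qBinom_zero]
      intro S hS
      rw [if_neg]
      intro h
      have := congrFun h (κ j)
      rw [hins S hS, if_pos rfl, hkj] at this
      omega
    · let k' : C → ℕ := Function.update k (κ j) d
      have hk' : ∀ c, c ∉ C₀ → k' c = 0 := fun c hc => by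
        rw [← hk c hc]
        exact Function.update_of_ne (fun h : c = κ j => hc (by rw [h]; exact hcj)) _ _
      have hiff : ∀ S ∈ X.powerset, colorCount κ (insert j S) = k ↔ colorCount κ S = k' := by
        intro S hS
        rw [funext_iff, funext_iff]
        refine forall_congr' fun c => ?_
        rw [hins S hS]
        by_cases hc : c = κ j
        · subst hc; simp [k', hkj]
        · simp [k', hc]
      have h2 : ∑ S ∈ X.powerset, (if colorCount κ (insert j S) = k then
          t ^ colorInv κ (insert j X) (insert j S) else 0) =
          t ^ (colorCount κ X (κ j) - d) * ∏ c ∈ C₀, qBinom t (colorCount κ X c) (k' c) := by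
        rw [← ih hC' k' hk', Finset.mul_sum]
        refine Finset.sum_congr rfl fun S hS => ?_
        simp only [hiff S hS]
        split_ifs with h
        · rw [colorInv_insert κ hj (Finset.mem_powerset.1 hS), congrFun h (κ j), pow_add, mul_comm]
          simp [k']
        · simp
      rw [h2, hsplit k fun _ _ => rfl, hsplit k' fun c hc => Function.update_of_ne hc _ _, hkj,
        qBinom_succ_succ]
      simp only [k', Function.update_self]
      ring

/-- The element of rank r within its color class contributes [r], so each class contributes a
factorial. -/
theorem prod_qInt_eq_prod_qFact (t : ℝ) (κ : ι → C) (X : Finset ι) (C₀ : Finset C)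
    (hC : ∀ j ∈ X, κ j ∈ C₀) :
    ∏ j ∈ X, qInt t ((X.filter fun i => i < j ∧ κ i = κ j).card + 1) =
      ∏ c ∈ C₀, qFact t (colorCount κ X c) := by
  induction X using Finset.induction_on_max with
  | empty => simp [colorCount, qFact]
  | insert j X hj ih =>
    have hjX : j ∉ X := fun h => lt_irrefl _ (hj j h)
    have h1 : ∀ c, qFact t (colorCount κ (insert j X) c) = qFact t (colorCount κ X c) *
        if c = κ j then qInt t (colorCount κ X (κ j) + 1) else 1 := fun c => by
      rw [colorCount_insert κ hjX]
      split_ifs with h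
      · rw [h, qFact_succ]
      · simp
    rw [Finset.prod_insert hjX, Finset.prod_congr rfl fun c _ => h1 c, Finset.prod_mul_distrib,
      ← ih fun i hi => hC i (Finset.mem_insert_of_mem hi), Finset.prod_ite_eq',
      if_pos (hC j (Finset.mem_insert_self _ _)), mul_comm]
    congr 1
    · refine Finset.prod_congr rfl fun i hi => ?_
      congr 3
      rw [Finset.filter_insert, if_neg fun h => (hj i hi).not_gt h.1]
    · congr 2
      rw [Finset.filter_insert, if_neg fun h => lt_irrefl _ h.1, colorCount]
      congr 1
      exact Finset.filter_congr fun i hi => by simp [hj i hi]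

end Colors

theorem eq_range_card_of_lower {B : Finset ℕ} (h : ∀ b ∈ B, ∀ a < b, a ∈ B) :
    B = Finset.range B.card := by
  refine Finset.eq_of_subset_of_card_le (fun b hb => ?_) (by simp)
  have : Finset.range (b + 1) ⊆ B := fun a ha => by
    rcases Nat.lt_succ_iff_lt_or_eq.1 (Finset.mem_range.1 ha) with h1 | rfl
    · exact h b hb a h1
    · exact hb
  have := Finset.card_le_card this
  rw [Finset.card_range] at this
  exact Finset.mem_range.2 this

theorem one_sub_pow_pos {t : ℝ} (ht : -1 < t) (ht' : t < 1) {j : ℕ} (hj : j ≠ 0) :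
    0 < 1 - t ^ j := by
  have h := pow_lt_one₀ (abs_nonneg t) (abs_lt.2 ⟨ht, ht'⟩) hj
  rw [← abs_pow] at h
  linarith [le_abs_self (t ^ j)]

theorem qInt_pos {t : ℝ} (ht : -1 < t) (ht' : t < 1) {j : ℕ} (hj : j ≠ 0) : 0 < qInt t j :=
  div_pos (one_sub_pow_pos ht ht' hj) (by linarith)

theorem qFact_pos {t : ℝ} (ht : -1 < t) (ht' : t < 1) (n : ℕ) : 0 < qFact t n :=
  Finset.prod_pos fun _ _ => qInt_pos ht ht' (Nat.succ_ne_zero _)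

theorem prod_range_ratio {t : ℝ} (ht : -1 < t) (ht' : t < 1) (d : ℕ) :
    ∏ i ∈ Finset.range d, (1 - t ^ (i + 1)) / (1 - t ^ (1 + (i + 1))) = (qInt t (d + 1))⁻¹ := by
  induction d with
  | zero =>
    have : 1 - t ≠ 0 := by linarith
    simp [qInt, this]
  | succ d ih =>
    have h1 := (one_sub_pow_pos ht ht' (Nat.succ_ne_zero d)).ne'
    have h2 := (one_sub_pow_pos ht ht' (Nat.succ_ne_zero (d + 1))).ne'
    rw [Finset.prod_range_succ, ih, qInt, qInt, add_comm 1 (d + 1)]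
    simp only [Nat.succ_eq_add_one] at h1 h2
    field_simp

/-- Color classes are intervals, so for a fixed larger index k the equally colored pairs have
heights 1, …, d without gaps. Their product telescopes to 1/[d + 1], where d + 1 is the rank of k in
its class. -/
theorem prod_posRoots_eq_prod_qFact {C : Type*} [DecidableEq C] {n : ℕ} {t : ℝ} (ht : -1 < t)
    (ht' : t < 1) (κ : Fin n → C) (hκ : ∀ i j k, i ≤ j → j ≤ k → κ i = κ k → κ j = κ k)
    (C₀ : Finset C) (hC : ∀ j, κ j ∈ C₀) :
    ∏ p ∈ (posRoots n).filter (fun p => κ p.1 = κ p.2), (1 - t ^ height p) / (1 - t ^ (1 + height p)) =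
      (∏ c ∈ C₀, qFact t (colorCount κ Finset.univ c))⁻¹ := by
  rw [← prod_qInt_eq_prod_qFact t κ Finset.univ C₀ fun j _ => hC j, ← Finset.prod_inv_distrib,
    posRoots, Finset.filter_filter, Finset.prod_filter, Fintype.prod_prod_type, Finset.prod_comm]
  refine Finset.prod_congr rfl fun k _ => ?_
  rw [← Finset.prod_filter]
  set A := Finset.univ.filter fun j : Fin n => j < k ∧ κ j = κ k with hA
  have hinj : Set.InjOn (fun j : Fin n => (k : ℕ) - 1 - j) A := by
    intro i hi j hj hij
    simp only [hA, Finset.coe_filter, Finset.mem_univ, true_and, Set.mem_ofPred_eq, Fin.lt_def] at *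
    rw [Fin.ext_iff]
    omega
  have hB : A.image (fun j : Fin n => (k : ℕ) - 1 - j) = Finset.range A.card := by
    rw [← Finset.card_image_of_injOn hinj]
    refine eq_range_card_of_lower fun b hb a hab => ?_
    simp only [hA, Finset.mem_image, Finset.mem_filter, Finset.mem_univ, true_and, Fin.lt_def] at hb ⊢
    obtain ⟨i, ⟨hi, hκi⟩, rfl⟩ := hb
    refine ⟨⟨(k : ℕ) - 1 - a, by omega⟩, ⟨by simp only []; omega, ?_⟩, by simp only []; omega⟩
    refine hκ i _ k ?_ ?_ hκi <;> simp only [Fin.le_def] <;> omega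
  rw [← prod_range_ratio ht ht', ← hB, Finset.prod_image hinj]
  refine Finset.prod_congr rfl fun j hj => ?_
  have hjk : (j : ℕ) < k := by simpa [hA] using (Finset.mem_filter.1 hj).2.1
  have : (k : ℕ) - 1 - j + 1 = height (j, k) := by simp only [height]; omega
  rw [this]

/-! ### Folding a sum over subsets onto the sorted subsets. -/

section Sorting

variable {n : ℕ} {C : Type*}

/-- A subset is sorted if it meets every color class in an initial segment. -/
def Sorted (κ : Fin n → C) (S : Finset (Fin n)) : Prop :=
  ∀ i j, i < j → κ i = κ j → j ∈ S → i ∈ S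

theorem Sorted.colorInv_eq_zero [DecidableEq C] {κ : Fin n → C} {S : Finset (Fin n)} (h : Sorted κ S) :
    colorInv κ Finset.univ S = 0 := by
  rw [colorInv, Finset.card_eq_zero, Finset.filter_eq_empty_iff]
  rintro ⟨i, j⟩ - ⟨h1, h2, h3, h4⟩
  exact h3 (h i j h1 h2 h4)

/-- Initial segments of a class are nested, so the color counts determine a sorted subset. -/
theorem Sorted.subset [DecidableEq C] {κ : Fin n → C} {S T : Finset (Fin n)} (hS : Sorted κ S) (hT : Sorted κ T)
    (h : colorCount κ S = colorCount κ T) : S ⊆ T := by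
  intro j hj
  by_contra hjT
  have hlt : colorCount κ T (κ j) < colorCount κ S (κ j) := by
    refine Finset.card_lt_card ((Finset.ssubset_iff_of_subset fun i hi => ?_).2
      ⟨j, by simp [hj], by simp [hjT]⟩)
    simp only [Finset.mem_filter] at hi ⊢
    refine ⟨?_, hi.2⟩
    rcases lt_trichotomy i j with hij | rfl | hij
    · exact hS i j hij hi.2 hj
    · exact absurd hi.1 hjT
    · exact absurd (hT j i hij hi.2.symm hi.1) hjT
  rw [h] at hlt
  exact lt_irrefl _ hlt

/-- Classes are intervals: between the two ends of an inversion, membership in S must switch on at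
two neighboring indices of the same class. -/
theorem exists_adjacent_inversion {κ : Fin n → C}
    (hκ : ∀ i j k, i ≤ j → j ≤ k → κ i = κ k → κ j = κ k) {S : Finset (Fin n)}
    (h : ¬ Sorted κ S) :
    ∃ a b : Fin n, (b : ℕ) = a + 1 ∧ κ a = κ b ∧ a ∉ S ∧ b ∈ S := by
  have key : ∀ d : ℕ, ∀ i j : Fin n, (j : ℕ) = i + 1 + d → κ i = κ j → i ∉ S → j ∈ S →
      ∃ a b : Fin n, (b : ℕ) = a + 1 ∧ κ a = κ b ∧ a ∉ S ∧ b ∈ S := by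
    intro d
    induction d with
    | zero => exact fun i j h1 h2 h3 h4 => ⟨i, j, h1, h2, h3, h4⟩
    | succ d ih =>
      intro i j h1 h2 h3 h4
      let k : Fin n := ⟨i + 1, by omega⟩
      have hk : κ k = κ j := hκ i k j (by simp [k, Fin.le_def]) (by simp [k, Fin.le_def]; omega) h2
      by_cases hkS : k ∈ S
      · exact ⟨i, k, rfl, h2.trans hk.symm, h3, hkS⟩
      · exact ih k j (by simp only [k]; omega) hk hkS h4
  simp only [Sorted, not_forall] at h
  obtain ⟨i, j, h1, h2, h3, h4⟩ := h
  exact key (j - i - 1) i j (by rw [Fin.lt_def] at h1; omega) h2 h4 h3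

theorem colorCount_map_swap [DecidableEq C] {κ : Fin n → C} {a b : Fin n} (hab : κ a = κ b)
    (S : Finset (Fin n)) :
    colorCount κ (S.map (Equiv.swap a b).toEmbedding) = colorCount κ S := by
  have hsw : ∀ i, κ (Equiv.swap a b i) = κ i := fun i => by
    rw [Equiv.swap_apply_def]
    split_ifs with h1 h2
    · rw [h1, hab]
    · rw [h2, hab]
    · rfl
  funext c
  rw [colorCount, colorCount, Finset.filter_map, Finset.card_map]
  congr 1
  exact Finset.filter_congr fun i _ => by simp [hsw]

/-- An adjacent transposition preserves the order of every pair except (a, b), so exactly that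
inversion disappears. -/
theorem colorInv_swap [DecidableEq C] {κ : Fin n → C} {a b : Fin n} (hb : (b : ℕ) = a + 1) (hab : κ a = κ b)
    {S : Finset (Fin n)} (ha : a ∉ S) (hbS : b ∈ S) :
    colorInv κ Finset.univ S =
      colorInv κ Finset.univ (S.map (Equiv.swap a b).toEmbedding) + 1 := by
  have hlt : a < b := by rw [Fin.lt_def]; omega
  have hsw : ∀ i, κ (Equiv.swap a b i) = κ i := fun i => by
    rw [Equiv.swap_apply_def]
    split_ifs with h1 h2
    · rw [h1, hab]
    · rw [h2, hab]
    · rfl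
  have hmem : ∀ i, i ∈ S.map (Equiv.swap a b).toEmbedding ↔ Equiv.swap a b i ∈ S := fun i => by
    rw [Finset.mem_map_equiv, Equiv.symm_swap]
  set s := Equiv.swap a b with hs
  have hss : ∀ i, s (s i) = i := fun i => Equiv.swap_apply_self _ _ _
  have hinj : Function.Injective (Prod.map s s) := s.injective.prodMap s.injective
  have hab_mem : (a, b) ∈ (Finset.univ ×ˢ Finset.univ : Finset (Fin n × Fin n)).filter fun p =>
      p.1 < p.2 ∧ κ p.1 = κ p.2 ∧ p.1 ∉ S ∧ p.2 ∈ S := by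
    simp [hlt, hab, ha, hbS]
  rw [colorInv, colorInv, ← Finset.card_erase_add_one hab_mem, ← Finset.card_image_of_injective _ hinj]
  congr 2
  ext ⟨j, k⟩
  simp only [Finset.mem_image, Finset.mem_filter, Finset.mem_product, Finset.mem_univ, and_true,
    Finset.mem_erase, true_and, Prod.exists, Prod.map_apply, Prod.mk.injEq, hmem]
  constructor
  · rintro ⟨j, k, ⟨hne, h1, h2, h3, h4⟩, rfl, rfl⟩
    refine ⟨swap_lt_swap hb h1 (by simpa using hne), ?_, ?_, ?_⟩
    · rw [hsw, hsw, h2]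
    · rwa [hss]
    · rwa [hss]
  · rintro ⟨h1, h2, h3, h4⟩
    have hne : (j, k) ≠ (a, b) := by
      rintro h
      obtain ⟨rfl, rfl⟩ := Prod.ext_iff.1 h
      simp only [hs, Equiv.swap_apply_left] at h3
      exact h3 hbS
    refine ⟨s j, s k, ⟨?_, swap_lt_swap hb h1 hne, ?_, h3, h4⟩, hss j, hss k⟩
    · intro h56
      obtain ⟨h5, h6⟩ : s j = a ∧ s k = b := by simpa using h56
      have h5' : j = b := by rw [← hss j, h5, hs, Equiv.swap_apply_left]
      have h6' : k = a := by rw [← hss k, h6, hs, Equiv.swap_apply_right]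
      rw [h5', h6'] at h1
      exact h1.not_gt hlt
    · rw [hsw, hsw, h2]

variable {V : Type*} [AddCommGroup V] [Module ℝ V]

/-- Bubble sort: each adjacent transposition costs a factor t and removes one inversion. -/
theorem exists_sorted [DecidableEq C] {κ : Fin n → C}
    (hκ : ∀ i j k, i ≤ j → j ≤ k → κ i = κ k → κ j = κ k) {t : ℝ} {g : Finset (Fin n) → V}
    (hg : ∀ (S : Finset (Fin n)) (a b : Fin n), (b : ℕ) = a + 1 → κ a = κ b → a ∉ S → b ∈ S →
      g S = t • g (S.map (Equiv.swap a b).toEmbedding)) (S : Finset (Fin n)) :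
    ∃ T, Sorted κ T ∧ colorCount κ T = colorCount κ S ∧
      g S = t ^ colorInv κ Finset.univ S • g T := by
  induction hN : colorInv κ Finset.univ S using Nat.strong_induction_on generalizing S with
  | _ N ih =>
    by_cases h : Sorted κ S
    · exact ⟨S, h, rfl, by rw [← hN, h.colorInv_eq_zero]; simp⟩
    · obtain ⟨a, b, hb, hab, ha, hbS⟩ := exists_adjacent_inversion hκ h
      have h1 := colorInv_swap hb hab ha hbS
      obtain ⟨T, hT, hc, hgT⟩ := ih (colorInv κ Finset.univ (S.map (Equiv.swap a b).toEmbedding))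
        (by omega) _ rfl
      refine ⟨T, hT, hc.trans (colorCount_map_swap hab S), ?_⟩
      rw [hg S a b hb hab ha hbS, hgT, smul_smul, ← hN, h1, pow_succ']

theorem colorCount_prod_true [DecidableEq C] (κ : Fin n → C) (S : Finset (Fin n)) (c : C) :
    colorCount (fun j => (κ j, decide (j ∈ S))) Finset.univ (c, true) = colorCount κ S c := by
  rw [colorCount, colorCount]
  congr 1
  ext j
  simp [Prod.ext_iff, and_comm]

theorem colorCount_prod_false [DecidableEq C] (κ : Fin n → C) (S : Finset (Fin n)) (c : C) :
    colorCount (fun j => (κ j, decide (j ∈ S))) Finset.univ (c, false) =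
      colorCount κ Finset.univ c - colorCount κ S c := by
  rw [colorCount, colorCount, colorCount, ← Finset.card_sdiff_of_subset
    (Finset.filter_subset_filter _ (Finset.subset_univ S))]
  congr 1
  ext j
  simp only [Finset.mem_filter, Finset.mem_univ, true_and, Prod.mk.injEq, Finset.mem_sdiff,
    decide_eq_false_iff_not]
  tauto

open Classical in
/-- Reduction of a sum over all subsets to a sum over the sorted subsets. -/
theorem prod_smul_sum_eq_sum_sorted [DecidableEq C] {κ : Fin n → C}
    (hκ : ∀ i j k, i ≤ j → j ≤ k → κ i = κ k → κ j = κ k) {t : ℝ} (ht : -1 < t) (ht' : t < 1)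
    {g : Finset (Fin n) → V}
    (hg : ∀ (S : Finset (Fin n)) (a b : Fin n), (b : ℕ) = a + 1 → κ a = κ b → a ∉ S → b ∈ S →
      g S = t • g (S.map (Equiv.swap a b).toEmbedding)) :
    (∏ p ∈ (posRoots n).filter (fun p => κ p.1 = κ p.2),
      (1 - t ^ height p) / (1 - t ^ (1 + height p))) • ∑ S, g S =
    ∑ S, if Sorted κ S then
      (∏ p ∈ (posRoots n).filter (fun p => κ p.1 = κ p.2 ∧ (p.1 ∈ S ↔ p.2 ∈ S)),
        (1 - t ^ height p) / (1 - t ^ (1 + height p))) • g S else 0 := by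
  choose T hT hTc hTg using exists_sorted hκ hg
  let C₀ : Finset C := Finset.univ.image κ
  have hC : ∀ j, κ j ∈ C₀ := fun j => Finset.mem_image_of_mem κ (Finset.mem_univ j)
  rw [← Finset.sum_filter, Finset.smul_sum, ← Finset.sum_fiberwise_of_maps_to
    (s := Finset.univ) (t := Finset.univ.filter (Sorted κ)) (g := T) fun S _ => by simp [hT]]
  refine Finset.sum_congr rfl fun S₀ hS₀ => ?_
  have hS : Sorted κ S₀ := (Finset.mem_filter.1 hS₀).2
  -- The subsets folding onto S₀ are those with its color counts, so their powers of t add up to a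
  -- product of Gaussian binomials.
  have hfib : ∀ S, T S = S₀ ↔ colorCount κ S = colorCount κ S₀ := fun S =>
    ⟨fun h => by rw [← h, hTc], fun h => ((hT S).subset hS ((hTc S).trans h)).antisymm
      (hS.subset (hT S) ((hTc S).trans h).symm)⟩
  have hk : ∀ c, c ∉ C₀ → colorCount κ S₀ c = 0 := fun c hc => by
    rw [colorCount, Finset.card_eq_zero, Finset.filter_eq_empty_iff]
    exact fun j _ h => hc (h ▸ hC j)
  have hQ := sum_pow_colorInv t κ Finset.univ C₀ (fun j _ => hC j) (colorCount κ S₀) hk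
  rw [Finset.powerset_univ, ← Finset.sum_filter] at hQ
  have h1 : ∑ S with T S = S₀, (∏ p ∈ (posRoots n).filter (fun p => κ p.1 = κ p.2),
      (1 - t ^ height p) / (1 - t ^ (1 + height p))) • g S =
      ((∏ p ∈ (posRoots n).filter (fun p => κ p.1 = κ p.2),
      (1 - t ^ height p) / (1 - t ^ (1 + height p))) *
        ∏ c ∈ C₀, qBinom t (colorCount κ Finset.univ c) (colorCount κ S₀ c)) • g S₀ := by
    rw [← hQ, mul_smul, Finset.sum_smul, Finset.smul_sum]
    refine Finset.sum_congr (by ext S; simp [hfib]) fun S hS' => ?_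
    have hTS : T S = S₀ := (hfib S).2 (by simpa using hS')
    rw [hTg S, hTS]
  have h2 := prod_posRoots_eq_prod_qFact ht ht' κ hκ C₀ hC
  -- Refining the coloring by membership in S₀ leaves the classes intervals, because S₀ is sorted.
  -- Class by class, the claim becomes binomial(N, k)/[N]! = 1/([k]! [N - k]!).
  have h3 := prod_posRoots_eq_prod_qFact ht ht' (fun j => (κ j, decide (j ∈ S₀)))
    (fun i j k hij hjk h => by
      obtain ⟨h4, h5⟩ := Prod.ext_iff.1 h
      have h6 := hκ i j k hij hjk h4
      have h7 : i ∈ S₀ ↔ k ∈ S₀ := by simpa using h5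
      refine Prod.ext h6 ?_
      simp only [decide_eq_decide]
      rcases hij.eq_or_lt with rfl | hij
      · exact h7
      rcases hjk.eq_or_lt with rfl | hjk
      · rfl
      exact ⟨fun hj => h7.1 (hS i j hij (h4.trans h6.symm) hj), fun hk => hS j k hjk h6 hk⟩)
    (C₀ ×ˢ Finset.univ) fun j => Finset.mem_product.2 ⟨hC j, Finset.mem_univ _⟩
  have h4 : ∀ p : Fin n × Fin n, ((κ p.1, decide (p.1 ∈ S₀)) = (κ p.2, decide (p.2 ∈ S₀))) ↔
      (κ p.1 = κ p.2 ∧ (p.1 ∈ S₀ ↔ p.2 ∈ S₀)) := fun p => by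
    rw [Prod.mk.injEq, decide_eq_decide]
  simp only [h4] at h3
  rw [h1, h2, h3, Finset.prod_product]
  congr 1
  rw [← Finset.prod_inv_distrib, ← Finset.prod_inv_distrib, ← Finset.prod_mul_distrib]
  refine Finset.prod_congr rfl fun c _ => ?_
  rw [Fintype.prod_bool, colorCount_prod_true, colorCount_prod_false]
  have hle : colorCount κ S₀ c ≤ colorCount κ Finset.univ c :=
    Finset.card_le_card (Finset.filter_subset_filter _ (Finset.subset_univ _))
  rw [← qBinom_mul t hle]
  have h5 := (qFact_pos ht ht' (colorCount κ S₀ c)).ne'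
  have h6 := (qFact_pos ht ht' (colorCount κ Finset.univ c - colorCount κ S₀ c)).ne'
  have h7 : qBinom t (colorCount κ Finset.univ c) (colorCount κ S₀ c) ≠ 0 :=
    left_ne_zero_of_mul (by rw [qBinom_mul t hle]; exact (qFact_pos ht ht' _).ne')
  field_simp

end Sorting

/-! ### Laplacians on the dilated alcove and their adjointness. -/

/-- The dilated alcove without the center-of-mass condition, restricted to vectors with integral
coordinate differences. -/
def Admissible {n : ℕ} (m : ℕ) (l : Fin n → ℝ) : Prop :=
  Antitone l ∧ (∀ j k, l j - l k ≤ m) ∧ ∀ j k, ∃ z : ℤ, l j - l k = z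

/-- The weight of a pair of neighboring points: only the walls containing both points count. -/
def pairWeight (n m : ℕ) (t : ℝ) (l l' : Fin n → ℝ) : ℝ :=
  (∏ p ∈ (posRoots n).filter (fun p => l p.1 = l p.2 ∧ l' p.1 = l' p.2),
      (1 - t ^ height p) / (1 - t ^ (1 + height p))) *
  ∏ p ∈ (posRoots n).filter (fun p => l p.1 - l p.2 = m ∧ l' p.1 - l' p.2 = m),
      (1 - t ^ (n - height p)) / (1 - t ^ (1 + n - height p))

theorem pairWeight_self (n m : ℕ) (t : ℝ) (l : Fin n → ℝ) :
    pairWeight n m t l l = weight n m t l := by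
  simp only [pairWeight, weight, and_self, root_dotProduct, sub_eq_zero]

theorem pairWeight_comm (n m : ℕ) (t : ℝ) (l l' : Fin n → ℝ) :
    pairWeight n m t l l' = pairWeight n m t l' l := by
  simp only [pairWeight, and_comm]

theorem pairWeight_congr {n m : ℕ} {t : ℝ} {l l' k k' : Fin n → ℝ}
    (h : ∀ i j, l i - l j = k i - k j) (h' : ∀ i j, l' i - l' j = k' i - k' j) :
    pairWeight n m t l l' = pairWeight n m t k k' := by
  have h1 : ∀ i j, l i = l j ↔ k i = k j := fun i j => by
    rw [← sub_eq_zero, h, sub_eq_zero]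
  have h2 : ∀ i j, l' i = l' j ↔ k' i = k' j := fun i j => by
    rw [← sub_eq_zero, h', sub_eq_zero]
  simp only [pairWeight, h, h', h1, h2]

theorem weight_pos {n : ℕ} (m : ℕ) {t : ℝ} (ht : -1 < t) (ht' : t < 1) (l : Fin n → ℝ) :
    0 < weight n m t l := by
  refine mul_pos (Finset.prod_pos fun p hp => ?_) (Finset.prod_pos fun p hp => ?_)
  all_goals
    have hlt : p.1 < p.2 := by simpa [posRoots] using (Finset.mem_filter.1 hp).1
    have h2 := p.2.2
    rw [Fin.lt_def] at hlt
    refine div_pos (one_sub_pow_pos ht ht' ?_) (one_sub_pow_pos ht ht' ?_) <;>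
      simp only [height] <;> omega

/-- The rotation exchanges finite walls (j, last) with affine walls (0, j + 1) and vice versa. With
n + 1 coordinates the heights are n - j and j + 1, which add up to n + 1, so the finite and affine
factors match. -/
theorem pairWeight_rot {n : ℕ} (m : ℕ) (t : ℝ) (l l' : Fin (n + 1) → ℝ) :
    pairWeight (n + 1) m t (rot m l) (rot m l') = pairWeight (n + 1) m t l l' := by
  have e1 : ∀ (l : Fin (n + 1) → ℝ) (j : Fin n),
      l (Fin.last n) + m = l j.castSucc ↔ l j.castSucc - l (Fin.last n) = m := fun l j => by
    constructor <;> intro h <;> linarith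
  have e2 : ∀ (l : Fin (n + 1) → ℝ) (j : Fin n),
      l (Fin.last n) + m - l j.castSucc = m ↔ l j.castSucc = l (Fin.last n) := fun l j => by
    constructor <;> intro h <;> linarith
  have h1 : ∀ j : Fin n, height ((0 : Fin (n + 1)), j.succ) = j + 1 := fun j => by
    simp [height]
  have h2 : ∀ j : Fin n, height (j.castSucc, Fin.last n) = n - j := fun j => by
    simp [height]
  have h3 : ∀ p : Fin n × Fin n, height (p.1.succ, p.2.succ) = height (p.1.castSucc, p.2.castSucc) :=
    fun p => by simp [height]
  have h4 : ∀ j : Fin n, n + 1 - (n - (j : ℕ)) = j + 1 := fun j => by omega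
  have h5 : ∀ j : Fin n, 1 + (n + 1) - (n - (j : ℕ)) = 1 + (j + 1) := fun j => by omega
  have h6 : ∀ j : Fin n, n + 1 - ((j : ℕ) + 1) = n - j := fun j => by omega
  have h7 : ∀ j : Fin n, 1 + (n + 1) - ((j : ℕ) + 1) = 1 + (n - j) := fun j => by omega
  simp only [pairWeight, Finset.prod_filter]
  rw [prod_posRoots_succ, prod_posRoots_succ, prod_posRoots_castSucc, prod_posRoots_castSucc]
  simp only [rot_zero, rot_succ, e1, e2, h1, h2, h3, h4, h5, h6, h7]
  ring

theorem admissible_rot_iff {n m : ℕ} {l : Fin (n + 1) → ℝ} :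
    Admissible m (rot m l) ↔ Admissible m l := by
  constructor
  · rintro ⟨h1, h2, h3⟩
    have hlast : ∀ j, l (Fin.last n) ≤ l j := fun j => by
      induction j using Fin.lastCases with
      | last => exact le_rfl
      | cast j =>
        have := h2 0 j.succ
        rw [rot_zero, rot_succ] at this
        linarith
    have hfst : ∀ j, l j ≤ l (Fin.last n) + m := fun j => by
      induction j using Fin.lastCases with
      | last => linarith [Nat.cast_nonneg (α := ℝ) m]
      | cast j =>
        have := h1 (Fin.zero_le j.succ)
        rwa [rot_zero, rot_succ] at this
    refine ⟨fun j k hjk => ?_, fun j k => ?_, fun j k => ?_⟩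
    · induction k using Fin.lastCases with
      | last => exact hlast j
      | cast k =>
        induction j using Fin.lastCases with
        | last => exact absurd hjk (Fin.castSucc_lt_last k).not_ge
        | cast j =>
          have := h1 (show j.succ ≤ k.succ by simpa using hjk)
          rwa [rot_succ, rot_succ] at this
    · linarith [hfst j, hlast k]
    · induction k using Fin.lastCases with
      | last =>
        induction j using Fin.lastCases with
        | last => exact ⟨0, by simp⟩
        | cast j =>
          obtain ⟨z, hz⟩ := h3 j.succ 0
          rw [rot_zero, rot_succ] at hz
          exact ⟨z + m, by push_cast; linarith⟩
      | cast k =>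
        induction j using Fin.lastCases with
        | last =>
          obtain ⟨z, hz⟩ := h3 0 k.succ
          rw [rot_zero, rot_succ] at hz
          exact ⟨z - m, by push_cast; linarith⟩
        | cast j =>
          obtain ⟨z, hz⟩ := h3 j.succ k.succ
          rw [rot_succ, rot_succ] at hz
          exact ⟨z, hz⟩
  · rintro ⟨h1, h2, h3⟩
    have hlast : ∀ j : Fin n, l (Fin.last n) ≤ l j.castSucc := fun j => h1 (Fin.le_last _)
    have hm : (0 : ℝ) ≤ m := Nat.cast_nonneg m
    refine ⟨fun j k hjk => ?_, fun j k => ?_, fun j k => ?_⟩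
    · induction j using Fin.cases with
      | zero =>
        induction k using Fin.cases with
        | zero => exact le_rfl
        | succ k =>
          rw [rot_zero, rot_succ]
          linarith [h2 k.castSucc (Fin.last n)]
      | succ j =>
        induction k using Fin.cases with
        | zero => simp at hjk
        | succ k =>
          rw [rot_succ, rot_succ]
          exact h1 (by simpa using hjk)
    · induction j using Fin.cases with
      | zero =>
        induction k using Fin.cases with
        | zero => simp
        | succ k =>
          rw [rot_zero, rot_succ]
          linarith [hlast k]
      | succ j =>
        induction k using Fin.cases with
        | zero =>
          rw [rot_zero, rot_succ]
          linarith [h2 j.castSucc (Fin.last n)]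
        | succ k => exact h2 _ _
    · induction j using Fin.cases with
      | zero =>
        induction k using Fin.cases with
        | zero => exact ⟨0, by simp⟩
        | succ k =>
          obtain ⟨z, hz⟩ := h3 (Fin.last n) k.castSucc
          exact ⟨z + m, by rw [rot_zero, rot_succ]; push_cast; linarith⟩
      | succ j =>
        induction k using Fin.cases with
        | zero =>
          obtain ⟨z, hz⟩ := h3 j.castSucc (Fin.last n)
          exact ⟨z - m, by rw [rot_zero, rot_succ]; push_cast; linarith⟩
        | succ k => exact h3 _ _

theorem rot_add_indic {n : ℕ} (m : ℕ) (l : Fin (n + 1) → ℝ) (S : Finset (Fin (n + 1))) :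
    rot m l + indic (S.map (finRotate (n + 1)).toEmbedding) = rot m (l + indic S) := by
  have h0 : (finRotate (n + 1)).symm 0 = Fin.last n := by
    rw [Equiv.symm_apply_eq, finRotate_last]
  have hs : ∀ j : Fin n, (finRotate (n + 1)).symm j.succ = j.castSucc := fun j => by
    rw [Equiv.symm_apply_eq]; simp
  funext j
  induction j using Fin.cases with
  | zero =>
    rw [Pi.add_apply, rot_zero, rot_zero, Pi.add_apply]
    simp only [indic, Finset.mem_map_equiv, h0]
    ring
  | succ j =>
    rw [Pi.add_apply, rot_succ, rot_succ, Pi.add_apply]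
    simp only [indic, Finset.mem_map_equiv, hs]

theorem indic_swap {n : ℕ} (a b : Fin n) (S : Finset (Fin n)) :
    indic (S.map (Equiv.swap a b).toEmbedding) = indic S ∘ Equiv.swap a b := by
  funext j
  simp [indic, Finset.mem_map_equiv]

open Classical in
/-- Reduction of the free Laplacian on the dilated alcove, away from the affine wall. -/
theorem pairWeight_mul_sum_of_lt {n m : ℕ} {t : ℝ} (ht : -1 < t) (ht' : t < 1)
    {Φ : (Fin (n + 1) → ℝ) → ℂ}
    (hswap : ∀ (a b : Fin (n + 1)) (l), (b : ℕ) = a + 1 → l b = l a + 1 →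
      Φ l = t * Φ (l ∘ Equiv.swap a b)) (r : ℕ) {l : Fin (n + 1) → ℝ} (hl : Admissible m l)
    (hlt : l 0 - l (Fin.last n) < m) :
    (pairWeight (n + 1) m t l l : ℂ) * ∑ S ∈ Finset.powersetCard r Finset.univ, Φ (l + indic S) =
      ∑ S ∈ Finset.powersetCard r Finset.univ, if Admissible m (l + indic S) then
        (pairWeight (n + 1) m t l (l + indic S) : ℂ) * Φ (l + indic S) else 0 := by
  obtain ⟨hanti, -, hint⟩ := hl
  have hlt' : ∀ i j, l i - l j < m := fun i j => by
    linarith [hanti (Fin.zero_le i), hanti (Fin.le_last j)]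
  -- Integrality leaves room for one unit step, so l + 1_S cannot cross the affine wall.
  -- Admissibility then only asks that S be sorted for the coloring by the values of l.
  have hle : ∀ i j, l i - l j ≤ m - 1 := fun i j => by
    obtain ⟨z, hz⟩ := hint i j
    have h := hlt' i j
    rw [hz] at h ⊢
    have : z < m := by exact_mod_cast h
    have : z ≤ m - 1 := by omega
    exact_mod_cast this
  have hP : ∀ l' : Fin (n + 1) → ℝ, pairWeight (n + 1) m t l l' =
      ∏ p ∈ (posRoots (n + 1)).filter (fun p => l p.1 = l p.2 ∧ l' p.1 = l' p.2),
        (1 - t ^ height p) / (1 - t ^ (1 + height p)) := fun l' => by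
    have he : (posRoots (n + 1)).filter
        (fun p => l p.1 - l p.2 = m ∧ l' p.1 - l' p.2 = m) = ∅ :=
      Finset.filter_false_of_mem fun p _ h => (hlt' p.1 p.2).ne h.1
    rw [pairWeight, he, Finset.prod_empty, mul_one]
  have hsorted : ∀ S, Sorted l S ↔ Admissible m (l + indic S) := by
    intro S
    have h01 : ∀ i, 0 ≤ indic S i ∧ indic S i ≤ 1 := fun i => by
      simp only [indic]; split_ifs <;> norm_num
    constructor
    · intro h
      refine ⟨fun i j hij => ?_, fun i j => ?_, fun i j => ?_⟩
      · simp only [Pi.add_apply]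
        rcases hij.eq_or_lt with rfl | hij
        · exact le_rfl
        rcases (hanti hij.le).eq_or_lt with heq | hne
        · rw [heq]
          by_cases hj : j ∈ S
          · simp [indic, hj, h i j hij heq.symm hj]
          · have : indic S j = 0 := by simp [indic, hj]
            linarith [(h01 i).1]
        · obtain ⟨z, hz⟩ := hint i j
          have h1 : (0 : ℝ) < z := by rw [← hz]; linarith
          have h2 : (1 : ℝ) ≤ z := by exact_mod_cast (by exact_mod_cast h1 : (0 : ℤ) < z)
          linarith [(h01 i).1, (h01 j).2]
      · simp only [Pi.add_apply]
        linarith [(h01 i).2, (h01 j).1, hle i j]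
      · obtain ⟨z, hz⟩ := hint i j
        refine ⟨z + (if i ∈ S then 1 else 0) - (if j ∈ S then 1 else 0), ?_⟩
        simp only [Pi.add_apply, indic]
        push_cast
        rw [← hz]
        ring
    · rintro ⟨h1, -, -⟩ i j hij heq hj
      by_contra hi
      have := h1 hij.le
      simp only [Pi.add_apply, indic, hi, hj, if_true, if_false] at this
      linarith
  let g : Finset (Fin (n + 1)) → ℂ := fun S => if S.card = r then Φ (l + indic S) else 0
  have hg : ∀ (S : Finset (Fin (n + 1))) (a b : Fin (n + 1)), (b : ℕ) = a + 1 → l a = l b →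
      a ∉ S → b ∈ S → g S = t • g (S.map (Equiv.swap a b).toEmbedding) := by
    intro S a b hab hl ha hb
    have h1 : l + indic (S.map (Equiv.swap a b).toEmbedding) = (l + indic S) ∘ Equiv.swap a b := by
      rw [indic_swap]
      funext j
      simp only [Pi.add_apply, Function.comp_apply, Equiv.swap_apply_def]
      split_ifs with h1 h2
      · rw [h1, hl]
      · rw [h2, hl]
      · rfl
    simp only [g, Finset.card_map, h1]
    split_ifs
    · rw [hswap a b (l + indic S) hab (by simp [indic, ha, hb, hl]), Complex.real_smul]
    · simp
  have h := prod_smul_sum_eq_sum_sorted (κ := l)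
    (fun i j k hij hjk h => le_antisymm (by rw [← h]; exact hanti hij) (hanti hjk)) ht ht' hg
  have hfil : ∀ f : Finset (Fin (n + 1)) → ℂ, ∑ S ∈ Finset.powersetCard r Finset.univ, f S =
      ∑ S, if S.card = r then f S else 0 := fun f => by
    rw [← Finset.sum_filter]
    exact Finset.sum_congr (by ext S; simp [Finset.mem_powersetCard]) fun _ _ => rfl
  rw [hfil, hfil, hP, ← Complex.real_smul]
  simp only [and_self]
  rw [h]
  refine Finset.sum_congr rfl fun S _ => ?_
  simp only [hsorted, g]
  by_cases hS : S.card = r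
  · simp only [hS, if_true]
    split_ifs
    · rw [hP, Complex.real_smul]
      congr 3
      refine Finset.filter_congr fun p _ => and_congr_right fun h1 => ?_
      simp only [Pi.add_apply, h1, add_right_inj, indic]
      by_cases h2 : p.1 ∈ S <;> by_cases h3 : p.2 ∈ S <;> simp [h2, h3]
    · rfl
  · simp [hS]

open Classical in
/-- Reduction of the free Laplacian on the dilated alcove. -/
theorem pairWeight_mul_sum {n m : ℕ} (hm : 1 ≤ m) {t : ℝ} (ht : -1 < t) (ht' : t < 1)
    {Φ : (Fin (n + 1) → ℝ) → ℂ}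
    (hswap : ∀ (a b : Fin (n + 1)) (l), (b : ℕ) = a + 1 → l b = l a + 1 →
      Φ l = t * Φ (l ∘ Equiv.swap a b))
    (hrot : ∃ z : ℂ, z ≠ 0 ∧ ∀ l, Φ (rot m l) = z * Φ l)
    (r : ℕ) {l : Fin (n + 1) → ℝ} (hl : Admissible m l) :
    (pairWeight (n + 1) m t l l : ℂ) * ∑ S ∈ Finset.powersetCard r Finset.univ, Φ (l + indic S) =
      ∑ S ∈ Finset.powersetCard r Finset.univ, if Admissible m (l + indic S) then
        (pairWeight (n + 1) m t l (l + indic S) : ℂ) * Φ (l + indic S) else 0 := by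
  obtain ⟨z, hz, hrot⟩ := hrot
  -- On the affine wall, `rot` moves a last coordinate l 0 - m to the front as l 0. The count of
  -- such coordinates drops, since m ≥ 1, until the affine wall is left.
  induction hN : (Finset.univ.filter fun j => l j = l 0 - m).card using Nat.strong_induction_on
    generalizing l with
  | _ N ih =>
    rcases (hl.2.1 0 (Fin.last n)).lt_or_eq with hlt | heq
    · exact pairWeight_mul_sum_of_lt ht ht' hswap r hl hlt
    have hm' : (1 : ℝ) ≤ m := by exact_mod_cast hm
    have hlast : l (Fin.last n) = l 0 - m := by linarith
    have hdec : (Finset.univ.filter fun j => rot m l j = rot m l 0 - m).card < N := by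
      rw [← hN, Finset.card_filter, Finset.card_filter, Fin.sum_univ_succ, Fin.sum_univ_castSucc]
      have h1 : l (Fin.last n) + m = l 0 := by linarith
      simp only [rot_zero, rot_succ, h1]
      rw [if_neg (by intro h; linarith), if_pos hlast]
      omega
    have h := ih _ hdec (admissible_rot_iff.2 hl) rfl
    have hre : ∀ f : Finset (Fin (n + 1)) → ℂ, ∑ S ∈ Finset.powersetCard r Finset.univ, f S =
        ∑ S ∈ Finset.powersetCard r Finset.univ, f (S.map (finRotate (n + 1)).toEmbedding) :=
      fun f => by
      symm
      refine Finset.sum_equiv (finRotate (n + 1)).finsetCongr (fun S => ?_) fun S _ => ?_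
      · simp [Finset.mem_powersetCard]
      · rfl
    rw [hre fun S => Φ (rot m l + indic S), hre fun S => if Admissible m (rot m l + indic S) then
      (pairWeight (n + 1) m t (rot m l) (rot m l + indic S) : ℂ) * Φ (rot m l + indic S) else 0] at h
    simp only [rot_add_indic, pairWeight_rot, admissible_rot_iff, hrot, ← Finset.mul_sum] at h
    apply mul_left_cancel₀ hz
    rw [mul_left_comm, h, Finset.mul_sum]
    refine Finset.sum_congr rfl fun S _ => ?_
    split_ifs
    · ring
    · simp

theorem admissible_of_mem_grid {n m : ℕ} {l : Fin n → ℝ} (h : l ∈ grid n m) : Admissible m l :=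
  ⟨h.2.2.1, h.2.2.2, weightLattice_sub h.1⟩

theorem center_mem_grid {n m : ℕ} (hn : 1 ≤ n) {l : Fin n → ℝ} (h : Admissible m l) :
    center l ∈ grid n m := by
  refine ⟨mem_weightLattice_iff.2 ⟨center_mem_plane hn l, fun j k => ?_⟩, center_mem_plane hn l,
    fun j k hjk => ?_, fun j k => ?_⟩
  · rw [center_sub]; exact h.2.2 j k
  · rw [← sub_nonneg, center_sub, sub_nonneg]; exact h.1 hjk
  · rw [center_sub]; exact h.2.1 j k

theorem Admissible.congr {n m : ℕ} {l k : Fin n → ℝ} (h : ∀ i j, l i - l j = k i - k j)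
    (hl : Admissible m l) : Admissible m k :=
  ⟨fun i j hij => by rw [← sub_nonneg, ← h, sub_nonneg]; exact hl.1 hij,
    fun i j => by rw [← h]; exact hl.2.1 i j, fun i j => by rw [← h]; exact hl.2.2 i j⟩

theorem indic_compl {n : ℕ} (S : Finset (Fin n)) (j : Fin n) : indic Sᶜ j = 1 - indic S j := by
  simp only [indic, Finset.mem_compl]
  split_ifs <;> simp_all

open Classical in
/-- The symmetry of the sum over pairs of neighboring points of the grid. -/
theorem sum_pairs_symm {n m : ℕ} (hn : 1 ≤ n) {t : ℝ} {Φ Φ' : (Fin n → ℝ) → ℂ}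
    (hΦ : ∀ l c, Φ (fun j => l j + c) = Φ l) (hΦ' : ∀ l c, Φ' (fun j => l j + c) = Φ' l)
    {r s : ℕ} (hrs : r + s = n) :
    ∑ l : grid n m, ∑ S ∈ Finset.powersetCard r Finset.univ, (if Admissible m ((l : Fin n → ℝ) + indic S) then
        (pairWeight n m t l ((l : Fin n → ℝ) + indic S) : ℂ) * Φ ((l : Fin n → ℝ) + indic S) * Φ' l else 0) =
      ∑ l : grid n m, ∑ S ∈ Finset.powersetCard s Finset.univ, if Admissible m ((l : Fin n → ℝ) + indic S) then
        (pairWeight n m t l ((l : Fin n → ℝ) + indic S) : ℂ) * Φ' ((l : Fin n → ℝ) + indic S) * Φ l else 0 := by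
  -- The vectors 1_S and 1_{Sᶜ} add up to a constant vector, so a step by S followed by a step by Sᶜ
  -- returns to l modulo constants. This reverses pairs of neighbors and exchanges r with s.
  have hd : ∀ (l : Fin n → ℝ) (S : Finset (Fin n)) (i j : Fin n),
      (center (l + indic S) + indic Sᶜ) i - (center (l + indic S) + indic Sᶜ) j = l i - l j := by
    intro l S i j
    have h := center_sub (l + indic S) i j
    simp only [Pi.add_apply, indic_compl] at h ⊢
    linarith
  have hshift : ∀ (Ψ : (Fin n → ℝ) → ℂ), (∀ l c, Ψ (fun j => l j + c) = Ψ l) →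
      ∀ l k : Fin n → ℝ, (∀ i j, l i - l j = k i - k j) → Ψ l = Ψ k := by
    intro Ψ hΨ l k h
    let o : Fin n := ⟨0, hn⟩
    rw [← hΨ k (l o - k o)]
    congr 1
    funext j
    linarith [h j o]
  rw [← Finset.sum_product', ← Finset.sum_product', ← Finset.sum_filter, ← Finset.sum_filter]
  have hmap : ∀ (r s : ℕ), r + s = n → ∀ a : grid n m × Finset (Fin n),
      (ha : a ∈ (Finset.univ ×ˢ Finset.powersetCard r Finset.univ).filter
        fun a : grid n m × Finset (Fin n) => Admissible m ((a.1 : Fin n → ℝ) + indic a.2)) →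
      ((⟨center ((a.1 : Fin n → ℝ) + indic a.2), center_mem_grid hn (Finset.mem_filter.1 ha).2⟩ :
        grid n m), a.2ᶜ) ∈ (Finset.univ ×ˢ Finset.powersetCard s Finset.univ).filter
        fun a : grid n m × Finset (Fin n) => Admissible m ((a.1 : Fin n → ℝ) + indic a.2) := by
    rintro r s hrs ⟨l, S⟩ ha
    obtain ⟨h1, h2⟩ := Finset.mem_filter.1 ha
    have hS : S.card = r := by simpa [Finset.mem_powersetCard] using h1
    refine Finset.mem_filter.2 ⟨?_, ?_⟩
    · simp [Finset.mem_powersetCard, Finset.card_compl, hS]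
      omega
    · exact (admissible_of_mem_grid l.2).congr fun i j => (hd l S i j).symm
  have hinv : ∀ (l : grid n m) (S : Finset (Fin n)),
      center (center ((l : Fin n → ℝ) + indic S) + indic Sᶜ) = l := fun l S => by
    refine (center_eq_center_iff.2 fun j k => ?_).trans (center_eq_self l.2.1.1)
    have := hd (l : Fin n → ℝ) S j k
    linarith
  refine Finset.sum_bij' (fun a ha => ((⟨center ((a.1 : Fin n → ℝ) + indic a.2),
      center_mem_grid hn (Finset.mem_filter.1 ha).2⟩ : grid n m), a.2ᶜ))
    (fun a ha => ((⟨center ((a.1 : Fin n → ℝ) + indic a.2),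
      center_mem_grid hn (Finset.mem_filter.1 ha).2⟩ : grid n m), a.2ᶜ))
    (hmap r s hrs) (hmap s r (by omega)) ?_ ?_ ?_
  · rintro ⟨l, S⟩ -
    exact Prod.ext (Subtype.ext (hinv l S)) (compl_compl S)
  · rintro ⟨l, S⟩ -
    exact Prod.ext (Subtype.ext (hinv l S)) (compl_compl S)
  · rintro ⟨l, S⟩ -
    simp only []
    rw [hshift Φ' hΦ' _ _ (hd l S), hshift Φ hΦ _ _ (center_sub ((l : Fin n → ℝ) + indic S)),
      pairWeight_comm, pairWeight_congr (center_sub ((l : Fin n → ℝ) + indic S)) (hd l S)]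
    ring

/-- The Laplacians `L_r` and `L_(n-r)` are mutually adjoint. -/
theorem sum_weight_adjoint {n m : ℕ} (hm : 1 ≤ m) {t : ℝ} (ht : -1 < t) (ht' : t < 1)
    {Φ Φ' : (Fin (n + 1) → ℝ) → ℂ}
    (hswap : ∀ (a b : Fin (n + 1)) (l), (b : ℕ) = a + 1 → l b = l a + 1 →
      Φ l = t * Φ (l ∘ Equiv.swap a b))
    (hrot : ∃ z : ℂ, z ≠ 0 ∧ ∀ l, Φ (rot m l) = z * Φ l)
    (hΦ : ∀ l c, Φ (fun j => l j + c) = Φ l)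
    (hswap' : ∀ (a b : Fin (n + 1)) (l), (b : ℕ) = a + 1 → l b = l a + 1 →
      Φ' l = t * Φ' (l ∘ Equiv.swap a b))
    (hrot' : ∃ z : ℂ, z ≠ 0 ∧ ∀ l, Φ' (rot m l) = z * Φ' l)
    (hΦ' : ∀ l c, Φ' (fun j => l j + c) = Φ' l) {r s : ℕ} (hrs : r + s = n + 1) :
    ∑ l : grid (n + 1) m, (weight (n + 1) m t l : ℂ) *
        (∑ S ∈ Finset.powersetCard r Finset.univ, Φ ((l : Fin (n + 1) → ℝ) + indic S)) * Φ' l =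
      ∑ l : grid (n + 1) m, (weight (n + 1) m t l : ℂ) *
        (∑ S ∈ Finset.powersetCard s Finset.univ, Φ' ((l : Fin (n + 1) → ℝ) + indic S)) * Φ l := by
  classical
  have h := sum_pairs_symm (m := m) (t := t) (by omega) hΦ hΦ' hrs
  simp only [← pairWeight_self]
  have h1 := fun (r : ℕ) (l : grid (n + 1) m) =>
    pairWeight_mul_sum hm ht ht' hswap hrot r (admissible_of_mem_grid l.2)
  have h2 := fun (r : ℕ) (l : grid (n + 1) m) =>
    pairWeight_mul_sum hm ht ht' hswap' hrot' r (admissible_of_mem_grid l.2)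
  simp only [h1, h2, Finset.sum_mul, ite_mul, zero_mul]
  exact h

/-! ### Separation by the eigenvalues and orthogonality. -/

theorem wave_indic {n : ℕ} (S : Finset (Fin n)) (ξ : Fin n → ℝ) :
    wave (indic S) ξ = ∏ j ∈ S, Complex.exp (Complex.I * (ξ j : ℂ)) := by
  rw [wave, ← Complex.exp_sum, ← Finset.mul_sum, ← Complex.ofReal_sum]
  congr 3
  simp [dotProduct, indic]

theorem prod_add_eq_sum_waveEsymm {n : ℕ} (ξ : Fin n → ℝ) (u : ℂ) :
    ∏ j, (Complex.exp (Complex.I * (ξ j : ℂ)) + u) =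
      ∑ r ∈ Finset.range (n + 1), waveEsymm r ξ * u ^ (n - r) := by
  classical
  rw [Finset.prod_add, Finset.sum_powerset, Finset.card_univ, Fintype.card_fin]
  refine Finset.sum_congr rfl fun r _ => ?_
  rw [waveEsymm, Finset.sum_mul]
  refine Finset.sum_congr rfl fun S hS => ?_
  have hc : S.card = r := (Finset.mem_powersetCard.1 hS).2
  rw [wave_indic, Finset.prod_const, ← Finset.compl_eq_univ_sdiff, Finset.card_compl, hc,
    Fintype.card_fin]

/-- The elementary symmetric functions separate the points of the open alcove. -/
theorem eq_of_waveEsymm_eq {n : ℕ} {ξ η : Fin n → ℝ} (hξ : ξ ∈ openAlcove n (2 * Real.pi))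
    (hη : η ∈ openAlcove n (2 * Real.pi)) (h : ∀ r ≤ n, waveEsymm r ξ = waveEsymm r η) :
    ξ = η := by
  have hpi := Real.two_pi_pos
  -- Equal elementary symmetric functions give equal polynomials, so each e^{iξ_a} is some e^{iη_b}.
  have hex : ∀ a, ∃ b, ∃ k : ℤ, ξ a = η b + k * (2 * Real.pi) := by
    intro a
    have h1 := prod_add_eq_sum_waveEsymm η (-Complex.exp (Complex.I * (ξ a : ℂ)))
    have h2 := prod_add_eq_sum_waveEsymm ξ (-Complex.exp (Complex.I * (ξ a : ℂ)))
    rw [Finset.prod_eq_zero (Finset.mem_univ a) (add_neg_cancel _)] at h2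
    rw [Finset.sum_congr rfl fun r hr => by
      rw [← h r (Nat.lt_succ_iff.1 (Finset.mem_range.1 hr))], ← h2] at h1
    obtain ⟨b, -, hb⟩ := Finset.prod_eq_zero_iff.1 h1
    rw [add_neg_eq_zero, eq_comm, Complex.exp_eq_exp_iff_exists_int] at hb
    obtain ⟨k, hk⟩ := hb
    refine ⟨b, k, ?_⟩
    have : (ξ a : ℂ) = η b + k * (2 * Real.pi) := by
      apply mul_left_cancel₀ Complex.I_ne_zero
      rw [hk]; ring
    exact_mod_cast this
  choose τ k hk using hex
  have hτ : Function.Injective τ := fun a b hab => by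
    by_contra hne
    refine wave_root_ne_one hξ hne ?_
    rw [wave_root, hk a, hk b, hab, Complex.exp_eq_one_iff]
    exact ⟨k a - k b, by push_cast; ring⟩
  have hsum : ∑ a, (k a : ℝ) = 0 := by
    have h1 : ∑ a, ξ a = ∑ a, (η (τ a) + k a * (2 * Real.pi)) :=
      Finset.sum_congr rfl fun a _ => hk a
    have h2 : ∑ a, η (τ a) = ∑ a, η a :=
      Equiv.sum_comp (Equiv.ofBijective τ (Finite.injective_iff_bijective.1 hτ)) η
    have h3 : ∑ a, ξ a = 0 := hξ.1
    have h4 : ∑ a, η a = 0 := hη.1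
    rw [Finset.sum_add_distrib, h2, h3, h4, ← Finset.sum_mul, zero_add] at h1
    exact (mul_eq_zero.1 h1.symm).resolve_right hpi.ne'
  have hsum' : ∑ a, k a = 0 := by exact_mod_cast hsum
  -- Both alcoves have width below 2π, so the winding numbers differ by at most 1. They are then all
  -- of one sign, and their sum is zero.
  have hdiff : ∀ a b, k a ≤ k b + 1 := fun a b => by
    have h1 := hξ.2.2 a b
    have h2 := hη.2.2 (τ b) (τ a)
    rw [hk a, hk b] at h1
    have h3 : ((k a : ℝ) - k b - 2) * (2 * Real.pi) < 0 := by linarith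
    have h4 : (k a : ℝ) - k b - 2 < 0 := by
      by_contra! h
      exact absurd h3 (mul_nonneg h hpi.le).not_gt
    have h5 : (k a : ℝ) < k b + 2 := by linarith
    have h6 : k a < k b + 2 := by exact_mod_cast h5
    omega
  have hk0 : ∀ a, k a = 0 := by
    have hcases : (∀ a, 0 ≤ k a) ∨ ∀ a, k a ≤ 0 := by
      by_contra! hcon
      obtain ⟨⟨a, ha⟩, b, hb⟩ := hcon
      have := hdiff b a
      omega
    rcases hcases with h0 | h0
    · exact fun a => (Finset.sum_eq_zero_iff_of_nonneg fun a _ => h0 a).1 hsum' a (Finset.mem_univ a)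
    · exact fun a => (Finset.sum_eq_zero_iff_of_nonpos fun a _ => h0 a).1 hsum' a (Finset.mem_univ a)
  have hk' : ∀ a, ξ a = η (τ a) := fun a => by rw [hk a, hk0 a]; simp
  have hmono : StrictMono τ := fun a b hab => by
    have h1 := hξ.2.1 hab
    rw [hk', hk'] at h1
    exact hη.2.1.lt_iff_gt.1 h1
  have hid : τ = id := (StrictMono.range_inj hmono strictMono_id).1 (by
    rw [(Finite.injective_iff_surjective.1 hτ).range_eq, Set.range_id])
  funext a
  rw [hk', hid, id]

theorem conj_wave {n : ℕ} (x ξ : Fin n → ℝ) : (starRingEnd ℂ) (wave x ξ) = wave (-x) ξ := by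
  rw [wave, wave, ← Complex.exp_conj, neg_dotProduct]
  simp

/-- The product of all e^{iξ_j} is 1, so the conjugate of the wave of S is the wave of its
complement. -/
theorem conj_waveEsymm {n r s : ℕ} (hrs : r + s = n) {ξ : Fin n → ℝ} (hξ : ξ ∈ plane n) :
    (starRingEnd ℂ) (waveEsymm s ξ) = waveEsymm r ξ := by
  have hξ' : ∑ j, ξ j = 0 := hξ
  rw [waveEsymm, map_sum, waveEsymm]
  refine Finset.sum_bij' (fun S _ => Sᶜ) (fun S _ => Sᶜ) ?_ ?_ ?_ ?_ ?_
  · intro S hS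
    have hc : S.card = s := (Finset.mem_powersetCard.1 hS).2
    simp [Finset.mem_powersetCard, Finset.card_compl, hc]
    omega
  · intro S hS
    have hc : S.card = r := (Finset.mem_powersetCard.1 hS).2
    simp [Finset.mem_powersetCard, Finset.card_compl, hc]
    omega
  · exact fun S _ => compl_compl S
  · exact fun S _ => compl_compl S
  · intro S _
    rw [conj_wave, wave, wave]
    congr 3
    simp only [dotProduct, Pi.neg_apply, indic_compl, sub_mul, one_mul, neg_mul,
      Finset.sum_sub_distrib, hξ', Finset.sum_neg_distrib]
    ring

theorem sum_weight_betheNumerator_eq_zero {n m : ℕ} (hm : 1 ≤ m) {t : ℝ} (ht : -1 < t)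
    (ht' : t < 1) {ξ η : Fin (n + 1) → ℝ} (hξ : ξ ∈ openAlcove (n + 1) (2 * Real.pi))
    (hη : η ∈ openAlcove (n + 1) (2 * Real.pi)) (hBξ : CyclicBetheSystem m t ξ)
    (hBη : CyclicBetheSystem m t η) (hne : ξ ≠ η) :
    ∑ l : grid (n + 1) m, (weight (n + 1) m t l : ℂ) * betheNumerator t ξ l *
      (starRingEnd ℂ) (betheNumerator t η l) = 0 := by
  have key : ∀ r s, r + s = n + 1 → (waveEsymm r ξ - waveEsymm r η) *
      ∑ l : grid (n + 1) m, (weight (n + 1) m t l : ℂ) * betheNumerator t ξ l *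
      (starRingEnd ℂ) (betheNumerator t η l) = 0 := by
    intro r s hrs
    obtain ⟨w, hw, hrot⟩ := betheNumerator_rot ht' hη.1 hBη
    -- The conjugate numerator obeys the same wall relations because t is real; the affine constant
    -- is conjugated.
    have h := sum_weight_adjoint hm ht ht' (Φ := betheNumerator t ξ)
      (Φ' := fun l => (starRingEnd ℂ) (betheNumerator t η l))
      (fun a b l hab hl => betheNumerator_swap t ξ hab hl) (betheNumerator_rot ht' hξ.1 hBξ)
      (fun l c => betheNumerator_add_const t hξ.1 l c)
      (fun a b l hab hl => by rw [betheNumerator_swap t η hab hl, map_mul, Complex.conj_ofReal])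
      ⟨(starRingEnd ℂ) w, by simpa using hw, fun l => by rw [hrot, map_mul]⟩
      (fun l c => by rw [betheNumerator_add_const t hη.1 l c]) hrs
    simp only [← map_sum, sum_betheNumerator_add_indic, map_mul, conj_waveEsymm hrs hη.1] at h
    rw [sub_mul, Finset.mul_sum, Finset.mul_sum, sub_eq_zero]
    calc _ = _ := Finset.sum_congr rfl fun l _ => by ring
      _ = _ := h
      _ = _ := Finset.sum_congr rfl fun l _ => by ring
  by_contra h0
  refine hne (eq_of_waveEsymm_eq hξ hη fun r hr => ?_)
  exact sub_eq_zero.1 ((mul_eq_zero.1 (key r (n + 1 - r) (by omega))).resolve_right h0)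

/-! ### Positive norms and the basis property. -/

theorem gridInner_self {n m : ℕ} {t : ℝ} (f : grid n m → ℂ) :
    gridInner n m t f f = ((∑ l : grid n m, weight n m t l * Complex.normSq (f l) : ℝ) : ℂ) := by
  rw [gridInner, Complex.ofReal_sum]
  refine Finset.sum_congr rfl fun l _ => ?_
  rw [Complex.mul_conj]
  push_cast
  ring

theorem zero_mem_grid (n m : ℕ) : (0 : Fin n → ℝ) ∈ grid n m :=
  ⟨mem_weightLattice_iff.2 ⟨by simp [plane], fun _ _ => ⟨0, by simp⟩⟩, by simp [plane],
    fun _ _ _ => le_rfl, fun _ _ => by simp⟩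

theorem sum_weight_normSq_pos {n m : ℕ} {t : ℝ} (ht : -1 < t) (ht' : t < 1) {f : grid n m → ℂ}
    (k : grid n m) (hk : f k ≠ 0) :
    0 < ∑ l : grid n m, weight n m t l * Complex.normSq (f l) := by
  have h0 : ∀ l : grid n m, 0 ≤ weight n m t l * Complex.normSq (f l) := fun l =>
    mul_nonneg (weight_pos m ht ht' (l : Fin n → ℝ)).le (Complex.normSq_nonneg (f l))
  have h1 : 0 < weight n m t k * Complex.normSq (f k) :=
    mul_pos (weight_pos m ht ht' (k : Fin n → ℝ)) (Complex.normSq_pos.2 hk)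
  exact h1.trans_le (Finset.single_le_sum (f := fun l : grid n m =>
    weight n m t l * Complex.normSq (f l)) (fun l _ => h0 l) (Finset.mem_univ k))

theorem linearIndependent_of_gridInner {n m : ℕ} {t : ℝ} {v : grid n m → grid n m → ℂ}
    (h : ∀ μ μ', μ ≠ μ' → gridInner n m t (v μ) (v μ') = 0)
    (h' : ∀ μ, gridInner n m t (v μ) (v μ) ≠ 0) : LinearIndependent ℂ v := by
  rw [Fintype.linearIndependent_iff]
  intro c hc μ
  have h1 : gridInner n m t (∑ ν, c ν • v ν) (v μ) = ∑ ν, c ν * gridInner n m t (v ν) (v μ) := by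
    simp only [gridInner, Finset.sum_apply, Pi.smul_apply, smul_eq_mul, Finset.sum_mul,
      Finset.mul_sum]
    rw [Finset.sum_comm]
    exact Finset.sum_congr rfl fun _ _ => Finset.sum_congr rfl fun _ _ => by ring
  rw [hc, Finset.sum_eq_single μ (fun ν _ hν => by rw [h ν μ hν, mul_zero]) (by simp)] at h1
  have h2 : gridInner n m t 0 (v μ) = 0 := by simp [gridInner]
  rw [h2] at h1
  exact (mul_eq_zero.1 h1.symm).resolve_right (h' μ)

theorem exists_basis_eq {ι : Type*} [Finite ι] [Nonempty ι] {v : ι → ι → ℂ}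
    (hv : LinearIndependent ℂ v) : ∃ b : Module.Basis ι ℂ (ι → ℂ), ∀ i j, b i j = v i j := by
  have := Fintype.ofFinite ι
  exact ⟨basisOfLinearIndependentOfCardEqFinrank hv (Module.finrank_fintype_fun_eq_card ℂ).symm,
    fun i j => by rw [coe_basisOfLinearIndependentOfCardEqFinrank]⟩

theorem gridInner_betheWave_eq_zero {n m : ℕ} (hn : 1 ≤ n) (hm : 1 ≤ m) {t : ℝ} (ht : -1 < t)
    (ht' : t < 1) {ξ η : Fin n → ℝ} (hξ : ξ ∈ openAlcove n (2 * Real.pi))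
    (hη : η ∈ openAlcove n (2 * Real.pi)) (hBξ : CyclicBetheSystem m t ξ)
    (hBη : CyclicBetheSystem m t η) (hne : ξ ≠ η) :
    gridInner n m t (fun l => betheWave t l ξ) (fun l => betheWave t l η) = 0 := by
  obtain ⟨n, rfl⟩ := Nat.exists_eq_add_of_le' hn
  have h : gridInner (n + 1) m t (fun l => betheWave t l ξ) (fun l => betheWave t l η) =
      (1 / weylDenominator ξ) * (starRingEnd ℂ) (1 / weylDenominator η) *
      ∑ l : grid (n + 1) m, (weight (n + 1) m t l : ℂ) * betheNumerator t ξ l *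
        (starRingEnd ℂ) (betheNumerator t η l) := by
    rw [gridInner, Finset.mul_sum]
    refine Finset.sum_congr rfl fun l _ => ?_
    rw [betheWave_eq, betheWave_eq, map_mul]
    ring
  rw [h, sum_weight_betheNumerator_eq_zero hm ht ht' hξ hη hBξ hBη hne, mul_zero]

theorem exists_pos_gridInner_betheWave_eq {n : ℕ} (m : ℕ) {t : ℝ} (ht : -1 < t) (ht' : t < 1)
    {ξ : Fin n → ℝ} (hξ : ξ ∈ openAlcove n (2 * Real.pi)) :
    ∃ c : ℝ, 0 < c ∧
      gridInner n m t (fun l => betheWave t l ξ) (fun l => betheWave t l ξ) = c := by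
  have h0 : betheWave t 0 ξ ≠ 0 := by
    rw [betheWave_eq_hallLittlewood t _ hξ]
    exact hallLittlewood_zero_ne_zero ht ht' hξ
  let f : grid n m → ℂ := fun l => betheWave t l ξ
  exact ⟨_, sum_weight_normSq_pos ht ht' (f := f) ⟨0, zero_mem_grid n m⟩ h0, gridInner_self f⟩

end BetheGas

end
open BetheGas in
theorem theorem5p2 (n m : ℕ) (hn : 1 ≤ n) (hm : 1 ≤ m) (t : ℝ) (ht : -1 < t) (ht' : t < 1) :
    -- the weight function is positive
    (∀ l : grid n m, 0 < weight n m t l) ∧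
    -- every label has exactly one Bethe vector `ξ μ`
    ∃ ξ : grid n m → Fin n → ℝ,
      (∀ (μ : grid n m) (η : Fin n → ℝ), IsBetheVector m t μ η ↔ η = ξ μ) ∧
      -- it lies in the open alcove and solves the Bethe system
      (∀ μ, ξ μ ∈ openAlcove n (2 * Real.pi) ∧ BetheSystem m t (ξ μ)) ∧
      -- the Bethe wave functions are specialized Hall--Littlewood polynomials
      (∀ μ l : grid n m, betheWave t l (ξ μ) = hallLittlewood t l (ξ μ)) ∧
      -- they form a basis
      (∃ b : Module.Basis (grid n m) ℂ (grid n m → ℂ),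
        ∀ μ l : grid n m, b μ l = betheWave t l (ξ μ)) ∧
      -- which is orthogonal
      (∀ μ μ' : grid n m, μ ≠ μ' →
        gridInner n m t (fun l => betheWave t l (ξ μ)) (fun l => betheWave t l (ξ μ')) = 0) ∧
      (∀ μ : grid n m, ∃ c : ℝ, 0 < c ∧
        gridInner n m t (fun l => betheWave t l (ξ μ)) (fun l => betheWave t l (ξ μ)) = c) := by
  have hex : ∀ μ : grid n m, ∃ ξ, IsBetheVector m t (μ : Fin n → ℝ) ξ := fun μ =>
    exists_isBetheVector hn hm ht ht' μ.2.1
  choose ξ hξ using hex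
  have halc : ∀ μ, ξ μ ∈ openAlcove n (2 * Real.pi) := fun μ =>
    (hξ μ).mem_openAlcove hn hm ht ht' μ.2
  have hcyc : ∀ μ, CyclicBetheSystem m t (ξ μ) := fun μ => by
    obtain ⟨q, y, -, hy, h⟩ := hξ μ
    rw [h]
    exact hy.cyclicBetheSystem ht ht'
  have horth : ∀ μ μ' : grid n m, μ ≠ μ' →
      gridInner n m t (fun l => betheWave t l (ξ μ)) (fun l => betheWave t l (ξ μ')) = 0 := by
    intro μ μ' hne
    have hne' : ξ μ ≠ ξ μ' := fun h =>
      hne (Subtype.ext ((hξ μ).label_unique (by rw [h]; exact hξ μ')))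
    exact gridInner_betheWave_eq_zero hn hm ht ht' (halc μ) (halc μ') (hcyc μ) (hcyc μ') hne'
  have hnorm : ∀ μ : grid n m, ∃ c : ℝ, 0 < c ∧
      gridInner n m t (fun l => betheWave t l (ξ μ)) (fun l => betheWave t l (ξ μ)) = c := fun μ =>
    exists_pos_gridInner_betheWave_eq m ht ht' (halc μ)
  have hnz : ∀ μ : grid n m,
      gridInner n m t (fun l => betheWave t l (ξ μ)) (fun l => betheWave t l (ξ μ)) ≠ 0 := by
    intro μ
    obtain ⟨c, hc, h⟩ := hnorm μ
    rw [h]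
    exact Complex.ofReal_ne_zero.2 hc.ne'
  let v : grid n m → grid n m → ℂ := fun μ l => betheWave t l (ξ μ)
  have hli : LinearIndependent ℂ v := linearIndependent_of_gridInner horth hnz
  have hne : Nonempty (grid n m) := ⟨⟨0, zero_mem_grid n m⟩⟩
  refine ⟨fun l => weight_pos m ht ht' (l : Fin n → ℝ), ξ,
    fun μ η => ⟨fun h => (hξ μ).unique hm ht ht' h, fun h => by rw [h]; exact hξ μ⟩, fun μ => ⟨halc μ, ?_⟩,
    fun μ l => betheWave_eq_hallLittlewood t (l : Fin n → ℝ) (halc μ),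
    exists_basis_eq hli, horth, hnorm⟩
  obtain ⟨q, y, -, hy, h⟩ := hξ μ
  rw [h]
  exact hy.betheSystem ht ht'
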